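/- Let $N\ge 1$, $c\in\{0,N\}$, and let $[x_k]=(x_0,\dots,x_N)$ be a nonsingular Gaussian (NG) sequence of $\mathbb R^d$-valued random vectors, i.e. jointly Gaussian with nonsingular covariance matrix of the stacked vector. Suppose that $[x_k]$ is $CM_c$, i.e. $F(\xi\mid x_0,\dots,x_j,x_c)=F(\xi\mid x_j,x_c)$ a.s. for the conditional distribution functions of $x_k$, for all $0\le j<k\le N$ and $\xi\in\mathbb R^d$. A *Markov-based representation* of $[x_k]$ is a representation $$x_k=y_k+\Gamma_k x_c \quad\text{a.s.},\qquad k\in[0,N]\setminus\{c\},$$ where $(y_k)_{k\in[0,N]\setminus\{c\}}$ is an NG Markov sequence, $x_c$ is an NG vector uncorrelated with all $y_k$, and the $\Gamma_k$ are (deterministic) $d\times d$ matrices. A *$CM_c$ model* of $[x_k]$ consists of matrices $G_{k,k-1},G_{k,c}$ ($k\in[1,N]\setminus\{c\}$), $G_{0,N}$ (only if $c=N$) and $G_k$ ($k\in[0,N]$) such that, with $\bar x_k=x_k-\mathbb E x_k$, $$\bar x_k=G_{k,k-1}\bar x_{k-1}+G_{k,c}\bar x_c+e_k,\quad k\in[1,N]\setminus\{c\};\qquad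 \bar x_c=e_c;\qquad \bar x_0=G_{0,N}\bar x_N+e_0\ \text{ if } c=N,$$ for a zero-mean white (mutually uncorrelated) NG sequence $[e_k]_0^N$ with $\operatorname{Cov}(e_k)=G_k$. (For $c=0$, $k=1$ the two coefficients are one and the same matrix, so $\bar x_1=2G_{1,0}\bar x_0+e_1$.) A *Markov model* of $(y_k)_{k\in[0,N]\setminus\{c\}}$ consists of matrices $U_{k,k-1}$ (for $k-1,k\in[0,N]\setminus\{c\}$) and $U_k$ (for $k\in[0,N]\setminus\{c\}$) such that, with $\bar y_k=y_k-\mathbb E y_k$, $\bar y_k=U_{k,k-1}\bar y_{k-1}+e_k$ whenever $k-1,k\in[0,N]\setminus\{c\}$, and $\bar y_k=e_k$ at the first time $k$ of $[0,N]\setminus\{c\}$, for a zero-mean white NG sequence $(e_k)$ with $\operatorname{Cov}(e_k)=U_k$. Then: 1. $[x_k]$ has a Markov-based representation (with $[y_k]$ zero-mean if $[x_k]$ is zero-mean), and it is unique: any two have the same matrices $\Gamma_k$ and a.s. the same $y_k$, for all $k\in[0,N]\setminus\{c\}$. 2. $[x_k]$ has a $CM_c$ model, and for every $CM_c$ model of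 $[x_k]$ the parameters of the representation are determined by those of the model: - $\operatorname{Cov}(x_c)=G_c$; - the underlying Markov sequence $(y_k)$ has exactly one Markov model, namely $U_{k,k-1}=G_{k,k-1}$ for $k-1,k\in[0,N]\setminus\{c\}$ and $U_k=G_k$ for $k\in[0,N]\setminus\{c\}$; - $\Gamma_0=G_{0,N}$ if $c=N$, $\Gamma_1=2G_{1,0}$ if $c=0$, and $\Gamma_k=G_{k,k-1}\Gamma_{k-1}+G_{k,c}$ for $k-1,k\in[0,N]\setminus\{c\}$. -/

import Mathlib

open MeasureTheory ProbabilityTheory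
open scoped Matrix

namespace CMSeq

/-- A stochastic sequence with state space `ℝ^d`. Only the values at the times of the index set
under consideration ever matter. -/
abbrev RandSeq (Ω : Type*) (d : ℕ) : Type _ := ℕ → Ω → (Fin d → ℝ)

section

variable {Ω : Type*} [MeasurableSpace Ω] {d : ℕ}

/-- Cross-covariance matrix `Cov(U, V)` of two random vectors. -/
noncomputable def covMat (μ : Measure Ω) (U V : Ω → Fin d → ℝ) : Matrix (Fin d) (Fin d) ℝ :=
  Matrix.of fun i j => covariance (fun ω => U ω i) (fun ω => V ω j) μ

/-- Covariance matrix of the whole stacked sequence `[Z_k]`, `k ∈ T`. -/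
noncomputable def blockCov (μ : Measure Ω) (T : Finset ℕ) (Z : RandSeq Ω d) :
    Matrix (T × Fin d) (T × Fin d) ℝ :=
  Matrix.of fun p q => covMat μ (Z p.1) (Z q.1) p.2 q.2

/-- `[Z_k]`, `k ∈ T`, is nonsingular Gaussian (NG): the random vectors are jointly Gaussian and the
covariance matrix of the stacked vector is nonsingular. No condition on the mean. -/
structure IsNG (μ : Measure Ω) (T : Finset ℕ) (Z : RandSeq Ω d) : Prop where
  measurable : ∀ k ∈ T, Measurable (Z k)
  gaussian : HasGaussianLaw (fun ω (k : T) => Z k ω) μ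
  nonsingular : (blockCov μ T Z).det ≠ 0

/-- `[Z_k]`, `k ∈ T`, is zero-mean. -/
def IsZeroMean (μ : Measure Ω) (T : Finset ℕ) (Z : RandSeq Ω d) : Prop :=
  ∀ k ∈ T, ∫ ω, Z k ω ∂μ = 0

/-- The centered sequence `Z_k - E[Z_k]`. -/
noncomputable def centered (μ : Measure Ω) (Z : RandSeq Ω d) : RandSeq Ω d :=
  fun k ω => Z k ω - ∫ ω', Z k ω' ∂μ

/-- The σ-algebra generated by the `Z_i`, `i ∈ S`. -/
@[reducible]
def sigmaOf (Z : RandSeq Ω d) (S : Finset ℕ) : MeasurableSpace Ω :=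
  ⨆ i ∈ S, MeasurableSpace.comap (Z i) inferInstance

/-- The conditional CDF `F(ξ | [Z_i], i ∈ S)` of the random vector `Z_k`, as a random variable:
the conditional probability of `{Z_k ≤ ξ}` (coordinatewise). -/
noncomputable def condDistFun (μ : Measure Ω) (Z : RandSeq Ω d) (k : ℕ) (ξ : Fin d → ℝ)
    (S : Finset ℕ) : Ω → ℝ :=
  condExp (sigmaOf Z S) μ (Set.indicator {ω | ∀ i, Z k ω i ≤ ξ i} (fun _ => (1 : ℝ)))

/-- `[Z_k]`, `k ∈ T`, is Markov:
`F(ξ_k | [Z_i], i ≤ j) = F(ξ_k | Z_j)` for all `j < k` in `T` and all `ξ_k`. -/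
def IsMarkov (μ : Measure Ω) (T : Finset ℕ) (Z : RandSeq Ω d) : Prop :=
  ∀ j ∈ T, ∀ k ∈ T, j < k → ∀ ξ : Fin d → ℝ,
    condDistFun μ Z k ξ (T.filter (· ≤ j)) =ᵐ[μ] condDistFun μ Z k ξ {j}

/-- `[Z_k]`, `k ∈ [0,N]`, is `CM_c`:
`F(ξ_k | [Z_i]_0^j, Z_c) = F(ξ_k | Z_j, Z_c)` for all `j < k` in `[0,N]` and all `ξ_k`. -/
def IsCM (μ : Measure Ω) (N c : ℕ) (Z : RandSeq Ω d) : Prop :=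
  ∀ j ∈ Finset.Icc 0 N, ∀ k ∈ Finset.Icc 0 N, j < k → ∀ ξ : Fin d → ℝ,
    condDistFun μ Z k ξ (insert c (Finset.Icc 0 j)) =ᵐ[μ] condDistFun μ Z k ξ {j, c}

/-- `[e_k]`, `k ∈ T`, is a zero-mean white NG sequence with `Cov(e_k) = Q_k`. -/
structure IsWhiteNG (μ : Measure Ω) (T : Finset ℕ) (e : RandSeq Ω d)
    (Q : ℕ → Matrix (Fin d) (Fin d) ℝ) : Prop where
  ng : IsNG μ T e
  zero_mean : IsZeroMean μ T e
  white : ∀ j ∈ T, ∀ k ∈ T, j ≠ k → covMat μ (e j) (e k) = 0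
  cov_eq : ∀ k ∈ T, covMat μ (e k) (e k) = Q k

/-- `[Z_k]`, `k ∈ [0,N]`, obeys the `CM_c` model with parameters `G_{k,k-1}`, `G_{k,c}`
(entries `G k (k-1)`, `G k c`) and noise covariances `Q_k`:
`Z_k = G_{k,k-1} Z_{k-1} + G_{k,c} Z_c + e_k` for `k ∈ [1,N] \ {c}`, with boundary condition
`Z_c = e_c` and, for `c = N`, `Z_0 = G_{0,c} Z_c + e_0`.
For `c = 0`, `k = 1` the two coefficients are the same matrix, so `Z_1 = 2 G_{1,0} Z_0 + e_1`. -/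
def IsCMModel (μ : Measure Ω) (N c : ℕ) (Z : RandSeq Ω d)
    (G : ℕ → ℕ → Matrix (Fin d) (Fin d) ℝ) (Q : ℕ → Matrix (Fin d) (Fin d) ℝ) : Prop :=
  ∃ e : RandSeq Ω d, IsWhiteNG μ (Finset.Icc 0 N) e Q ∧
    (∀ k ∈ (Finset.Icc 1 N).erase c,
      Z k =ᵐ[μ] fun ω => G k (k - 1) *ᵥ Z (k - 1) ω + G k c *ᵥ Z c ω + e k ω) ∧
    Z c =ᵐ[μ] e c ∧
    (c = N → Z 0 =ᵐ[μ] fun ω => G 0 c *ᵥ Z c ω + e 0 ω)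

/-- `[Z_k]`, `k ∈ T` (an interval of times), obeys the Markov model with parameters `U_{k,k-1}`
and noise covariances `Q_k`: `Z_k = U_{k,k-1} Z_{k-1} + e_k`, and `Z_k = e_k` at the first time. -/
def IsMarkovModel (μ : Measure Ω) (T : Finset ℕ) (Z : RandSeq Ω d)
    (U : ℕ → ℕ → Matrix (Fin d) (Fin d) ℝ) (Q : ℕ → Matrix (Fin d) (Fin d) ℝ) : Prop :=
  ∃ e : RandSeq Ω d, IsWhiteNG μ T e Q ∧
    (∀ k, k ∈ T → k + 1 ∈ T →
      Z (k + 1) =ᵐ[μ] fun ω => U (k + 1) k *ᵥ Z k ω + e (k + 1) ω) ∧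
    (∀ k ∈ T, (∀ j ∈ T, k ≤ j) → Z k =ᵐ[μ] e k)

/-- The times `[0,N] \ {c}`. -/
def timesOff (N c : ℕ) : Finset ℕ := (Finset.Icc 0 N).erase c

/-- Markov-based representation `X_k = Y_k + Γ_k X_c`, `k ∈ [0,N] \ {c}`, where
`[Y_k] \ {Y_c}` is an NG Markov sequence and `X_c` is an NG vector uncorrelated with it. -/
structure IsMarkovRep (μ : Measure Ω) (N c : ℕ) (X Y : RandSeq Ω d)
    (Γ : ℕ → Matrix (Fin d) (Fin d) ℝ) : Prop where
  ng : IsNG μ (timesOff N c) Y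
  markov : IsMarkov μ (timesOff N c) Y
  ng_c : IsNG μ {c} X
  uncorrelated : ∀ k ∈ timesOff N c, covMat μ (Y k) (X c) = 0
  eq : ∀ k ∈ timesOff N c, X k =ᵐ[μ] fun ω => Y k ω + Γ k *ᵥ X c ω

end

end CMSeq

/-! For jointly Gaussian vectors a conditional distribution function statement is a statement about
covariances: conditioning `Z k` on a larger set `S` or on a subset `S'` gives the same result
exactly when the residual of `Z k` after regression on `S'` is uncorrelated with every term of `S`.
One direction is `IsNG.condDistFun_congr` (an uncorrelated residual is independent, so both
conditional laws are the same function of the predictor). The other is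
`IsNG.exists_regression_of_condDistFun_congr` (equal distribution functions give equal conditional
means). After this translation only second-moment algebra remains.

The $CM_c$ property thus says that $x_k$ minus a combination of $x_j$ and $x_c$ is uncorrelated with
$x_0,\dots,x_j,x_c$. In a representation, correlating with $x_c$ forces
$\Gamma_k=\operatorname{Cov}(x_k,x_c)\operatorname{Cov}(x_c)^{-1}$, hence uniqueness. For existence
take this $\Gamma_k$ and $y_k=x_k-\Gamma_kx_c$: the residual of $x_k$ on $x_j,x_c$ turns out to be
the residual of $y_k$ on $y_j$, which makes $(y_k)$ Markov.

A $CM_c$ model comes from one-step regressions, the residuals being the white noise. Conversely,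
inserting $x_k=y_k+\Gamma_kx_c$ into a model leaves a Markov recursion for $y$ plus a multiple of
$x_c$. Everything else is uncorrelated with $x_c$, so by `coeff_eq_zero` the multiple vanishes; that
is the recursion for $\Gamma_k$. Uniqueness of Markov models then gives the remaining claim.

Nonsingularity is used throughout in the form: no nontrivial linear combination of the coordinates
is almost surely constant (`det_gram_ne_zero_iff`). -/

namespace CMSeq

/-! ### Bilinearity of the cross-covariance matrix. -/

section CovarianceAlgebra

variable {Ω : Type*} [MeasurableSpace Ω] {μ : Measure Ω} {d : ℕ}

theorem covariance_congr_ae {f f' g g' : Ω → ℝ} (hf : f =ᵐ[μ] f') (hg : g =ᵐ[μ] g') :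
    covariance f g μ = covariance f' g' μ := by
  unfold covariance
  rw [integral_congr_ae hf, integral_congr_ae hg]
  refine integral_congr_ae ?_
  filter_upwards [hf, hg] with ω h1 h2
  rw [h1, h2]

theorem covMat_congr_ae {U U' V V' : Ω → Fin d → ℝ} (hU : U =ᵐ[μ] U') (hV : V =ᵐ[μ] V') :
    covMat μ U V = covMat μ U' V' := by
  ext i j
  refine covariance_congr_ae ?_ ?_
  · filter_upwards [hU] with ω h
    rw [h]
  · filter_upwards [hV] with ω h
    rw [h]

theorem covMat_transpose (U V : Ω → Fin d → ℝ) : (covMat μ U V)ᵀ = covMat μ V U := by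
  ext i j
  exact covariance_comm _ _

theorem covMat_eq_zero_comm {U V : Ω → Fin d → ℝ} : covMat μ U V = 0 ↔ covMat μ V U = 0 := by
  rw [← covMat_transpose, Matrix.transpose_eq_zero]

theorem memLp_mulVec {U : Ω → Fin d → ℝ} (hU : MemLp U 2 μ) (A : Matrix (Fin d) (Fin d) ℝ) :
    MemLp (fun ω => A *ᵥ U ω) 2 μ := by
  refine memLp_pi_iff.2 fun i => ?_
  simp only [Matrix.mulVec, dotProduct]
  exact memLp_finsetSum _ fun j _ => (hU.eval j).const_mul _

variable [IsProbabilityMeasure μ]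

theorem covMat_add_left {U U' V : Ω → Fin d → ℝ} (hU : MemLp U 2 μ) (hU' : MemLp U' 2 μ)
    (hV : MemLp V 2 μ) :
    covMat μ (fun ω => U ω + U' ω) V = covMat μ U V + covMat μ U' V := by
  ext i j
  exact covariance_add_left (hU.eval i) (hU'.eval i) (hV.eval j)

theorem covMat_sub_left {U U' V : Ω → Fin d → ℝ} (hU : MemLp U 2 μ) (hU' : MemLp U' 2 μ)
    (hV : MemLp V 2 μ) :
    covMat μ (fun ω => U ω - U' ω) V = covMat μ U V - covMat μ U' V := by
  ext i j
  exact covariance_sub_left (hU.eval i) (hU'.eval i) (hV.eval j)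

theorem covMat_mulVec_left {U V : Ω → Fin d → ℝ} (hU : MemLp U 2 μ) (hV : MemLp V 2 μ)
    (A : Matrix (Fin d) (Fin d) ℝ) :
    covMat μ (fun ω => A *ᵥ U ω) V = A * covMat μ U V := by
  ext i j
  simp only [covMat, Matrix.of_apply, Matrix.mulVec, dotProduct, Matrix.mul_apply]
  rw [covariance_fun_sum_left' (fun l _ => (hU.eval l).const_mul _) (hV.eval j)]
  exact Finset.sum_congr rfl fun l _ => covariance_const_mul_left _

theorem covMat_add_const_left {U V : Ω → Fin d → ℝ} (hU : MemLp U 2 μ) (b : Fin d → ℝ) :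
    covMat μ (fun ω => U ω + b) V = covMat μ U V := by
  ext i j
  exact covariance_add_const_left ((hU.eval i).integrable one_le_two) _

theorem covMat_sub_const_left {U V : Ω → Fin d → ℝ} (hU : MemLp U 2 μ) (b : Fin d → ℝ) :
    covMat μ (fun ω => U ω - b) V = covMat μ U V := by
  simpa [sub_eq_add_neg] using covMat_add_const_left (V := V) hU (-b)

theorem covMat_sum_left {T : Finset ℕ} {U : ℕ → Ω → Fin d → ℝ} {V : Ω → Fin d → ℝ}
    (hU : ∀ k ∈ T, MemLp (U k) 2 μ) (hV : MemLp V 2 μ) :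
    covMat μ (fun ω => ∑ k ∈ T, U k ω) V = ∑ k ∈ T, covMat μ (U k) V := by
  ext i j
  simp only [covMat, Matrix.of_apply, Finset.sum_apply, Matrix.sum_apply]
  exact covariance_fun_sum_left' (fun l hl => (hU l hl).eval i) (hV.eval j)

theorem covMat_centered_left {X : RandSeq Ω d} {k : ℕ} {V : Ω → Fin d → ℝ}
    (hX : MemLp (X k) 2 μ) : covMat μ (centered μ X k) V = covMat μ (X k) V :=
  covMat_sub_const_left hX _

theorem covMat_centered_right {X : RandSeq Ω d} {k : ℕ} {V : Ω → Fin d → ℝ}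
    (hX : MemLp (X k) 2 μ) : covMat μ V (centered μ X k) = covMat μ V (X k) := by
  rw [← covMat_transpose, covMat_centered_left hX, covMat_transpose]

theorem memLp_centered {X : RandSeq Ω d} {k : ℕ} (hX : MemLp (X k) 2 μ) :
    MemLp (centered μ X k) 2 μ :=
  hX.sub (memLp_const _)

end CovarianceAlgebra

/-! ### Nonsingular covariance matrices and linear independence modulo constants. -/

section Gram

variable {Ω : Type*} [MeasurableSpace Ω] {μ : Measure Ω} [IsProbabilityMeasure μ]
  {ι : Type*} [Fintype ι]

/-- Bilinearity and symmetry. It turns kernel vectors of a covariance matrix, and solutions of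
normal equations, into facts about random variables. -/
theorem gram_mulVec {f : ι → Ω → ℝ} (hf : ∀ i, MemLp (f i) 2 μ) (w : ι → ℝ) (i : ι) :
    ((Matrix.of fun i j => covariance (f i) (f j) μ) *ᵥ w) i =
      covariance (fun ω => ∑ j, w j * f j ω) (f i) μ := by
  rw [covariance_fun_sum_left (fun j => (hf j).const_mul _) (hf i)]
  simp only [Matrix.mulVec, dotProduct, Matrix.of_apply]
  refine Finset.sum_congr rfl fun j _ => ?_
  rw [covariance_const_mul_left, mul_comm, covariance_comm]

/-- A covariance matrix is nonsingular iff no nontrivial linear combination of the random variables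
is almost surely constant. -/
theorem det_gram_ne_zero_iff [DecidableEq ι] {f : ι → Ω → ℝ} (hf : ∀ i, MemLp (f i) 2 μ) :
    (Matrix.of fun i j => covariance (f i) (f j) μ).det ≠ 0 ↔
      ∀ (w : ι → ℝ) (a : ℝ), (∀ᵐ ω ∂μ, ∑ j, w j * f j ω = a) → w = 0 := by
  rw [Ne, ← Matrix.exists_mulVec_eq_zero_iff]
  constructor
  · intro h w a hw
    by_contra h0
    refine h ⟨w, h0, ?_⟩
    ext i
    rw [gram_mulVec hf, covariance_congr_ae (f' := fun _ => a) (g' := f i) hw (ae_eq_refl _)]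
    simp
  · rintro h ⟨w, h0, hw⟩
    set U : Ω → ℝ := fun ω => ∑ j, w j * f j ω with hU
    have hU2 : MemLp U 2 μ := memLp_finsetSum _ fun j _ => (hf j).const_mul _
    -- A kernel vector gives a combination uncorrelated with each `f j`, hence with itself: its
    -- variance is zero and it is almost surely constant.
    have h1 : covariance U U μ = 0 := by
      rw [hU, covariance_fun_sum_right (fun j => (hf j).const_mul _) hU2]
      refine Finset.sum_eq_zero fun j _ => ?_
      rw [covariance_const_mul_right, ← gram_mulVec hf, hw]
      simp
    rw [covariance_self hU2.aemeasurable] at h1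
    exact h0 (h w _ (ae_eq_integral_of_variance_eq_zero hU2 h1))

end Gram

/-! ### Affine functions of a sequence. -/

section Affine

variable {Ω : Type*} {d : ℕ} {T : Finset ℕ} {Z : RandSeq Ω d}

/-- The random vector `W` is an affine function of `[Z_k]`, `k ∈ T`. -/
def AffineIn (T : Finset ℕ) (Z : RandSeq Ω d) (W : Ω → Fin d → ℝ) : Prop :=
  ∃ (A : ℕ → Matrix (Fin d) (Fin d) ℝ) (b : Fin d → ℝ), ∀ ω, W ω = ∑ k ∈ T, A k *ᵥ Z k ω + b

namespace AffineIn

variable {W W' : Ω → Fin d → ℝ}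

theorem self {k : ℕ} (hk : k ∈ T) : AffineIn T Z (Z k) := by
  refine ⟨fun i => if i = k then 1 else 0, 0, fun ω => ?_⟩
  rw [add_zero, Finset.sum_eq_single_of_mem k hk]
  · simp
  · intro i _ hi
    simp [hi]

theorem mono {S : Finset ℕ} (h : AffineIn S Z W) (hS : S ⊆ T) : AffineIn T Z W := by
  obtain ⟨A, b, h⟩ := h
  refine ⟨fun k => if k ∈ S then A k else 0, b, fun ω => ?_⟩
  rw [h ω, ← Finset.sum_subset hS fun k _ hk => by simp [hk]]
  congr 1
  exact Finset.sum_congr rfl fun k hk => by simp [hk]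

theorem const (b : Fin d → ℝ) : AffineIn T Z fun _ => b :=
  ⟨0, b, fun ω => by simp⟩

theorem add (h : AffineIn T Z W) (h' : AffineIn T Z W') : AffineIn T Z fun ω => W ω + W' ω := by
  obtain ⟨A, b, h⟩ := h
  obtain ⟨A', b', h'⟩ := h'
  refine ⟨A + A', b + b', fun ω => ?_⟩
  simp only [h, h', Pi.add_apply, Matrix.add_mulVec, Finset.sum_add_distrib]
  abel

theorem mulVec (h : AffineIn T Z W) (M : Matrix (Fin d) (Fin d) ℝ) :
    AffineIn T Z fun ω => M *ᵥ W ω := by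
  obtain ⟨A, b, h⟩ := h
  refine ⟨fun k => M * A k, M *ᵥ b, fun ω => ?_⟩
  simp only [h, Matrix.mulVec_add, Matrix.mulVec_sum, Matrix.mulVec_mulVec]

theorem sub (h : AffineIn T Z W) (h' : AffineIn T Z W') : AffineIn T Z fun ω => W ω - W' ω := by
  simpa [sub_eq_add_neg, Matrix.neg_mulVec] using h.add (h'.mulVec (-1))

theorem sum {I : Finset ℕ} {V : ℕ → Ω → Fin d → ℝ} (h : ∀ i ∈ I, AffineIn T Z (V i)) :
    AffineIn T Z fun ω => ∑ i ∈ I, V i ω := by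
  induction I using Finset.induction_on with
  | empty => simpa using const 0
  | insert i I hi ih =>
    simp only [Finset.sum_insert hi]
    exact (h i (by simp)).add (ih fun j hj => h j (by simp [hj]))

theorem measurable {m : MeasurableSpace Ω} (h : AffineIn T Z W)
    (hZ : ∀ k ∈ T, Measurable[m] (Z k)) : Measurable[m] W := by
  obtain ⟨A, b, h⟩ := h
  rw [funext h]
  refine Measurable.add_const (Finset.measurable_sum _ fun k hk => ?_) b
  refine measurable_pi_iff.2 fun i => ?_
  simp only [Matrix.mulVec, dotProduct]
  exact Finset.measurable_sum _ fun j _ => ((measurable_pi_iff.1 (hZ k hk)) j).const_mul _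

end AffineIn

end Affine

/-! ### Nonsingular Gaussian sequences: closure properties and linear regression. -/

section NG

variable {Ω : Type*} [MeasurableSpace Ω] {μ : Measure Ω} {d : ℕ}
  {T : Finset ℕ} {Z : RandSeq Ω d}

theorem IsNG.memLp (hZ : IsNG μ T Z) {k : ℕ} (hk : k ∈ T) : MemLp (Z k) 2 μ :=
  (hZ.gaussian.eval (⟨k, hk⟩ : T)).memLp_two

theorem sum_subtype_prod (T : Finset ℕ) (v : ℕ → Fin d → ℝ) (z : ℕ → Fin d → ℝ) :
    ∑ p : T × Fin d, v p.1 p.2 * z p.1 p.2 = ∑ k ∈ T, v k ⬝ᵥ z k := by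
  rw [Fintype.sum_prod_type, ← Finset.sum_coe_sort T (fun k => v k ⬝ᵥ z k)]
  rfl

/-- Extension by zero of a stacked vector. -/
def unstack (T : Finset ℕ) (w : T × Fin d → ℝ) (k : ℕ) (i : Fin d) : ℝ :=
  if hk : k ∈ T then w (⟨k, hk⟩, i) else 0

theorem unstack_apply (w : T × Fin d → ℝ) (p : T × Fin d) : unstack T w p.1 p.2 = w p := by
  simp [unstack]

/-- Mutually uncorrelated vectors with nonsingular covariances have a nonsingular stacked
covariance. -/
theorem det_blockCov_ne_zero_of_white
    (hw : ∀ j ∈ T, ∀ k ∈ T, j ≠ k → covMat μ (Z j) (Z k) = 0)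
    (hd : ∀ k ∈ T, (covMat μ (Z k) (Z k)).det ≠ 0) : (blockCov μ T Z).det ≠ 0 := by
  rw [Ne, ← Matrix.exists_mulVec_eq_zero_iff]
  rintro ⟨w, h0, hw0⟩
  refine h0 (funext fun ⟨k, i⟩ => ?_)
  have hk : covMat μ (Z k) (Z k) *ᵥ (fun j => w (k, j)) = 0 := by
    ext l
    have := congrFun hw0 (k, l)
    simp only [Matrix.mulVec, dotProduct, Fintype.sum_prod_type, Pi.zero_apply] at this ⊢
    rw [Finset.sum_eq_single_of_mem k (Finset.mem_univ _)] at this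
    · exact this
    · intro j _ hj
      refine Finset.sum_eq_zero fun m _ => ?_
      have h := hw k k.2 j j.2 (fun h => hj (Subtype.ext h.symm))
      simp [blockCov, h]
  exact congrFun (Matrix.eq_zero_of_mulVec_eq_zero (hd k k.2) hk) i

theorem hasGaussianLaw_affine {E F : Type*} [NormedAddCommGroup E] [NormedSpace ℝ E]
    [FiniteDimensional ℝ E] [MeasurableSpace E] [BorelSpace E] [NormedAddCommGroup F]
    [NormedSpace ℝ F] [MeasurableSpace F] [BorelSpace F] [SecondCountableTopology F]
    {X : Ω → E} (hX : HasGaussianLaw X μ) (L : E →ₗ[ℝ] F) (b : F) :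
    HasGaussianLaw (fun ω => L (X ω) + b) μ := by
  have h1 := hX.map_fun (LinearMap.toContinuousLinearMap L)
  have h2 := h1.isGaussian_map
  refine ⟨?_⟩
  have : IsGaussian (Measure.map (fun x => x + b)
    (Measure.map (fun ω => LinearMap.toContinuousLinearMap L (X ω)) μ)) := inferInstance
  rwa [AEMeasurable.map_map_of_aemeasurable (by fun_prop) h1.aemeasurable] at this

theorem IsNG.hasGaussianLaw_of_affineIn (hZ : IsNG μ T Z) {κ : Type*} [Fintype κ]
    {W : κ → Ω → Fin d → ℝ} (hW : ∀ k, AffineIn T Z (W k)) :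
    HasGaussianLaw (fun ω k => W k ω) μ := by
  choose A b h using hW
  let L : (T → Fin d → ℝ) →ₗ[ℝ] (κ → Fin d → ℝ) :=
    LinearMap.pi fun k => ∑ i : T, (Matrix.mulVecLin (A k i)).comp (LinearMap.proj i)
  have := hasGaussianLaw_affine hZ.gaussian L b
  refine this.congr (ae_of_all _ fun ω => funext fun k => ?_)
  change (L fun k => Z k ω) k + b k = W k ω
  rw [h k ω, ← Finset.sum_coe_sort T (fun i => A k i *ᵥ Z i ω)]
  simp [L]

variable [IsProbabilityMeasure μ]

/-- In this form nonsingularity passes through linear changes of variables by merely rewriting the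
coefficients `v`. -/
theorem det_blockCov_ne_zero_iff (hZ : ∀ k ∈ T, MemLp (Z k) 2 μ) :
    (blockCov μ T Z).det ≠ 0 ↔ ∀ (v : ℕ → Fin d → ℝ) (a : ℝ),
      (∀ᵐ ω ∂μ, ∑ k ∈ T, v k ⬝ᵥ Z k ω = a) → ∀ k ∈ T, v k = 0 := by
  have key := det_gram_ne_zero_iff (μ := μ) (f := fun (p : T × Fin d) ω => Z p.1 ω p.2)
    (fun p => (hZ p.1 p.1.2).eval p.2)
  refine Iff.trans key ⟨fun h v a hv k hk => ?_, fun h w a hw => ?_⟩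
  · have := h (fun p => v p.1 p.2) a (by
      filter_upwards [hv] with ω hω
      rw [← hω]
      exact sum_subtype_prod T v fun k => Z k ω)
    ext i
    exact congrFun this (⟨k, hk⟩, i)
  · have := h (unstack T w) a (by
      filter_upwards [hw] with ω hω
      rw [← hω, ← sum_subtype_prod]
      simp only [unstack_apply])
    ext p
    rw [← unstack_apply w, this p.1 p.1.2]
    rfl

theorem det_covMat_ne_zero_iff {W : Ω → Fin d → ℝ} (hW : MemLp W 2 μ) :
    (covMat μ W W).det ≠ 0 ↔ ∀ (v : Fin d → ℝ) (a : ℝ),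
      (∀ᵐ ω ∂μ, v ⬝ᵥ W ω = a) → v = 0 :=
  det_gram_ne_zero_iff (μ := μ) (f := fun i ω => W ω i) fun i => hW.eval i

theorem IsNG.eq_zero_of_sum_ae_const (hZ : IsNG μ T Z) {v : ℕ → Fin d → ℝ} {a : ℝ}
    (h : ∀ᵐ ω ∂μ, ∑ k ∈ T, v k ⬝ᵥ Z k ω = a) {k : ℕ} (hk : k ∈ T) : v k = 0 :=
  (det_blockCov_ne_zero_iff fun _ hk => hZ.memLp hk).1 hZ.nonsingular v a h k hk

namespace AffineIn

variable {W : Ω → Fin d → ℝ}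

theorem memLp (h : AffineIn T Z W) (hZ : ∀ k ∈ T, MemLp (Z k) 2 μ) : MemLp W 2 μ := by
  obtain ⟨A, b, h⟩ := h
  rw [funext h]
  exact (memLp_finsetSum _ fun k hk => memLp_mulVec (hZ k hk) (A k)).add (memLp_const b)

theorem covMat_eq_zero (h : AffineIn T Z W) (hZ : ∀ k ∈ T, MemLp (Z k) 2 μ)
    {V : Ω → Fin d → ℝ} (hV : MemLp V 2 μ) (h0 : ∀ k ∈ T, covMat μ (Z k) V = 0) :
    covMat μ W V = 0 := by
  obtain ⟨A, b, h⟩ := h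
  rw [funext h, covMat_add_const_left
    (memLp_finsetSum _ fun k hk => memLp_mulVec (hZ k hk) (A k)),
    covMat_sum_left (fun k hk => memLp_mulVec (hZ k hk) (A k)) hV]
  refine Finset.sum_eq_zero fun k hk => ?_
  rw [covMat_mulVec_left (hZ k hk) hV, h0 k hk, mul_zero]

end AffineIn

theorem IsNG.subset (hZ : IsNG μ T Z) {S : Finset ℕ} (hS : S ⊆ T) : IsNG μ S Z where
  measurable k hk := hZ.measurable k (hS hk)
  gaussian := hZ.hasGaussianLaw_of_affineIn fun k : S => AffineIn.self (hS k.2)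
  nonsingular := by
    refine (det_blockCov_ne_zero_iff fun k hk => hZ.memLp (hS hk)).2 fun v a hv k hk => ?_
    have := hZ.eq_zero_of_sum_ae_const (v := fun k => if k ∈ S then v k else 0) (a := a) (by
      filter_upwards [hv] with ω hω
      rw [← hω, ← Finset.sum_subset hS (fun k _ hk => by simp [hk])]
      exact Finset.sum_congr rfl fun k hk => by simp [hk]) (hS hk)
    simpa [hk] using this

/-- A nonsingular Gaussian vector minus an affine function of the others has nonsingular
covariance. -/
theorem IsNG.det_covMat_sub_ne_zero (hZ : IsNG μ T Z) {k : ℕ} (hk : k ∈ T)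
    {V : Ω → Fin d → ℝ} (hV : AffineIn (T.erase k) Z V) :
    (covMat μ (fun ω => Z k ω - V ω) (fun ω => Z k ω - V ω)).det ≠ 0 := by
  have hV2 := hV.memLp fun i hi => hZ.memLp (Finset.mem_of_mem_erase hi)
  refine (det_covMat_ne_zero_iff ((hZ.memLp hk).sub hV2)).2 fun v a hv => ?_
  obtain ⟨A, b, h⟩ := hV
  have := hZ.eq_zero_of_sum_ae_const
    -- The coefficient of `Z k` in the expansion of `v ⬝ᵥ (Z k - V)` is `v` itself, because `V` does
    -- not involve `Z k`.
    (v := fun i => if i = k then v else -(v ᵥ* A i)) (a := a + v ⬝ᵥ b) (by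
      filter_upwards [hv] with ω hω
      rw [← hω, ← Finset.add_sum_erase _ _ hk, Pi.sub_apply, h ω]
      rw [Finset.sum_congr rfl (g := fun i => - (v ⬝ᵥ A i *ᵥ Z i ω))]
      · simp [dotProduct_add, dotProduct_sub, dotProduct_sum]
        ring
      · intro i hi
        simp [Finset.ne_of_mem_erase hi, Matrix.dotProduct_mulVec]) hk
  simpa using this

theorem IsNG.det_covMat_ne_zero (hZ : IsNG μ T Z) {k : ℕ} (hk : k ∈ T) :
    (covMat μ (Z k) (Z k)).det ≠ 0 := by
  simpa using hZ.det_covMat_sub_ne_zero hk (AffineIn.const 0)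

theorem eq_zero_of_mul_det_ne_zero {A M : Matrix (Fin d) (Fin d) ℝ} (hM : M.det ≠ 0)
    (h : A * M = 0) : A = 0 := by
  have hu : IsUnit M.det := hM.isUnit
  rw [← Matrix.mul_nonsing_inv_cancel_right _ A hu, h, zero_mul]

/-- Linear regression of a square integrable variable on an NG sequence. -/
theorem IsNG.exists_regression (hZ : IsNG μ T Z) {W : Ω → Fin d → ℝ} (hW : MemLp W 2 μ) :
    ∃ G : ℕ → Matrix (Fin d) (Fin d) ℝ,
      ∀ s ∈ T, covMat μ (fun ω => W ω - ∑ k ∈ T, G k *ᵥ Z k ω) (Z s) = 0 := by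
  set C := blockCov μ T Z with hC
  have hu : IsUnit C.det := hZ.nonsingular.isUnit
  have hf : ∀ p : T × Fin d, MemLp (fun ω => Z p.1 ω p.2) 2 μ :=
    fun p => (hZ.memLp p.1.2).eval p.2
  -- The solution of the normal equations for the `i`-th coordinate of `W`.
  let w : Fin d → T × Fin d → ℝ := fun i =>
    C⁻¹ *ᵥ fun p => covariance (fun ω => W ω i) (fun ω => Z p.1 ω p.2) μ
  refine ⟨fun k => Matrix.of fun i => unstack T (w i) k, fun s hs => ?_⟩
  ext i j
  have h1 : ∀ ω, (W ω - ∑ k ∈ T, Matrix.of (fun i => unstack T (w i) k) *ᵥ Z k ω) i =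
      W ω i - ∑ p : T × Fin d, w i p * Z p.1 ω p.2 := by
    intro ω
    rw [Pi.sub_apply, Finset.sum_apply]
    congr 1
    have := sum_subtype_prod T (unstack T (w i)) fun k => Z k ω
    simp only [unstack_apply] at this
    rw [this]
    rfl
  have h2 : (C *ᵥ w i) (⟨s, hs⟩, j) = covariance (fun ω => W ω i) (fun ω => Z s ω j) μ := by
    simp only [w]
    rw [Matrix.mulVec_mulVec, Matrix.mul_nonsing_inv _ hu, Matrix.one_mulVec]
  have h3 := gram_mulVec hf (w i) (⟨s, hs⟩, j)
  change (C *ᵥ w i) (⟨s, hs⟩, j) = _ at h3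
  simp only [covMat, Matrix.of_apply, h1, Matrix.zero_apply]
  rw [covariance_fun_sub_left (hW.eval i) (memLp_finsetSum _ fun p _ => (hf p).const_mul _)
    ((hZ.memLp hs).eval j), ← h2, h3, sub_self]

end NG

end CMSeq

namespace CMSeq

/-! ### Conditional distribution functions versus conditional expectations. -/

section CondExp

variable {Ω : Type*} {m m' m0 : MeasurableSpace Ω} {μ : Measure Ω} {d : ℕ}

/-- Lower orthants are products of half-lines, so they form a π-system generating the product
σ-algebra. -/
theorem measure_ext_of_Iic_pi {ν ν' : Measure (Fin d → ℝ)} [IsFiniteMeasure ν]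
    (h : ∀ ξ, ν (Set.Iic ξ) = ν' (Set.Iic ξ)) (huniv : ν Set.univ = ν' Set.univ) : ν = ν' := by
  have himage : (Set.univ.pi '' Set.univ.pi fun _ : Fin d => Set.range (Set.Iic (α := ℝ))) =
      Set.range (Set.Iic (α := Fin d → ℝ)) := by
    ext s
    constructor
    · rintro ⟨t, ht, rfl⟩
      choose ξ hξ using fun i => ht i (Set.mem_univ i)
      exact ⟨ξ, by rw [← funext hξ, Set.pi_univ_Iic]⟩
    · rintro ⟨ξ, rfl⟩
      exact ⟨fun i => Set.Iic (ξ i), fun i _ => ⟨ξ i, rfl⟩, Set.pi_univ_Iic ξ⟩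
  refine ext_of_generate_finite (Set.range (Set.Iic (α := Fin d → ℝ))) ?_ ?_ ?_ huniv
  · rw [← himage]
    refine (generateFrom_eq_pi (fun i => ?_) fun i => ?_).symm
    · exact (borel_eq_generateFrom_Iic ℝ).symm.trans (BorelSpace.measurable_eq (α := ℝ)).symm
    · exact ⟨fun n : ℕ => Set.Iic (n : ℝ), fun n => ⟨n, rfl⟩,
        Set.eq_univ_of_forall fun x => Set.mem_iUnion.2 (exists_nat_ge x)⟩
  · rw [← himage]
    exact IsPiSystem.pi fun _ => isPiSystem_Iic
  · rintro _ ⟨ξ, rfl⟩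
    exact h ξ

theorem condExp_indicator_bound (m' : MeasurableSpace Ω) (A : Set Ω) :
    ∀ᵐ ω ∂μ, ‖(μ[A.indicator fun _ => (1 : ℝ) | m']) ω‖ ≤ 1 := by
  refine ae_bdd_abs_condExp_of_ae_bdd_abs (R := 1) (ae_of_all _ fun ω => ?_)
  by_cases h : ω ∈ A <;> simp [h]

variable [IsProbabilityMeasure μ]

/-- Conditional expectation is self-adjoint: both sides equal the integral of `μ[1_A | m'] * μ[g |
m']`. -/
theorem integral_indicator_mul_condExp (hm' : m' ≤ m0) {A : Set Ω} (hA : MeasurableSet A)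
    {g : Ω → ℝ} (hg : Integrable g μ) :
    ∫ ω in A, (μ[g | m']) ω ∂μ = ∫ ω, (μ[A.indicator fun _ => (1 : ℝ) | m']) ω * g ω ∂μ := by
  set u : Ω → ℝ := A.indicator fun _ => (1 : ℝ) with hu
  have hui : Integrable u μ := (integrable_const 1).indicator hA
  have huE : ∀ f : Ω → ℝ, u * f = A.indicator f := by
    intro f
    ext ω
    by_cases h : ω ∈ A <;> simp [hu, h]
  have h1 : μ[u * μ[g | m'] | m'] =ᵐ[μ] μ[u | m'] * μ[g | m'] := by
    rw [mul_comm u, mul_comm (μ[u | m'])]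
    refine condExp_mul_of_stronglyMeasurable_left stronglyMeasurable_condExp ?_ hui
    rw [mul_comm, huE]
    exact integrable_condExp.indicator hA
  have h2 : μ[μ[u | m'] * g | m'] =ᵐ[μ] μ[u | m'] * μ[g | m'] :=
    condExp_mul_of_stronglyMeasurable_left stronglyMeasurable_condExp
      (hg.bdd_mul (integrable_condExp.aestronglyMeasurable) (condExp_indicator_bound m' A)) hg
  rw [← integral_indicator hA, ← huE, ← integral_condExp hm', integral_congr_ae (h1.trans h2.symm),
    integral_condExp hm']
  rfl

/-- Equality of conditional distribution functions implies equality of conditional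
expectations. -/
theorem condExp_eval_congr_of_condExp_Iic (hmm : m' ≤ m) (hm : m ≤ m0) {W : Ω → Fin d → ℝ}
    (hW : Measurable[m0] W) (hWi : Integrable W μ)
    (h : ∀ ξ : Fin d → ℝ, μ[{ω | ∀ i, W ω i ≤ ξ i}.indicator fun _ => (1 : ℝ) | m] =ᵐ[μ]
      μ[{ω | ∀ i, W ω i ≤ ξ i}.indicator fun _ => (1 : ℝ) | m']) (i : Fin d) :
    μ[fun ω => W ω i | m'] =ᵐ[μ] μ[fun ω => W ω i | m] := by
  have hm' : m' ≤ m0 := hmm.trans hm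
  have hWi' : Integrable (fun ω => W ω i) μ := hWi.eval i
  refine ae_eq_condExp_of_forall_setIntegral_eq hm hWi'
    (fun _ _ _ => integrable_condExp.integrableOn) (fun A hA _ => ?_)
    (stronglyMeasurable_condExp.mono hmm).aestronglyMeasurable
  have hA0 : MeasurableSet A := hm A hA
  rw [integral_indicator_mul_condExp hm' hA0 hWi']
  set g := μ[A.indicator fun _ => (1 : ℝ) | m'] with hg
  have hg0 : 0 ≤ᵐ[μ] g := condExp_nonneg (ae_of_all _ (Set.indicator_nonneg fun _ _ => zero_le_one))
  have hgi : Integrable g μ := integrable_condExp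
  have hgm : Measurable g := (stronglyMeasurable_condExp.mono hm').measurable
  -- The law of `W` under `μ` restricted to `A` is compared with its law under the density `g =
  -- μ[1_A | m']`. By self-adjointness, integrating `g` over `B` amounts to integrating `μ[1_B |
  -- m']` over `A`. For `B` the preimage of an orthant, the hypothesis replaces `m'` by `m`, which
  -- gives the measure of `A ∩ B`. Only one `ξ` is used at a time, so null sets depending on `ξ` do
  -- no harm.
  have hgE : ∀ B : Set Ω, MeasurableSet B →
      μ.withDensity (fun ω => ENNReal.ofReal (g ω)) B =
        ENNReal.ofReal (∫ ω in A, (μ[B.indicator fun _ => (1 : ℝ) | m']) ω ∂μ) := by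
    intro B hB
    rw [withDensity_apply _ hB, ← ofReal_integral_eq_lintegral_ofReal hgi.integrableOn
      (ae_restrict_of_ae hg0), integral_indicator_mul_condExp hm' hA0
        ((integrable_const 1).indicator hB), ← integral_indicator hB]
    congr 2
    ext ω
    by_cases h : ω ∈ B <;> simp [h, hg]
  have hmeas : (μ.restrict A).map W = (μ.withDensity fun ω => ENNReal.ofReal (g ω)).map W := by
    refine measure_ext_of_Iic_pi (fun ξ => ?_) ?_
    · have hB : MeasurableSet (W ⁻¹' Set.Iic ξ) := hW measurableSet_Iic
      rw [Measure.map_apply hW measurableSet_Iic, Measure.map_apply hW measurableSet_Iic,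
        hgE _ hB, Measure.restrict_apply hB]
      have h1 := setIntegral_congr_ae hA0 ((h ξ).mono fun ω hω _ => hω)
      have hset : W ⁻¹' Set.Iic ξ = {ω | ∀ i, W ω i ≤ ξ i} := rfl
      rw [hset] at hB ⊢
      rw [← h1, setIntegral_condExp hm ((integrable_const 1).indicator hB) hA,
        integral_indicator hB]
      simp [Measure.restrict_apply hB, measureReal_def]
    · rw [Measure.map_apply hW .univ, Measure.map_apply hW .univ, Set.preimage_univ, hgE _ .univ]
      simp [condExp_const hm', measureReal_def]
  calc ∫ ω, g ω * W ω i ∂μ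
      = ∫ ω, W ω i ∂(μ.withDensity fun ω => ENNReal.ofReal (g ω)) := by
        rw [integral_withDensity_eq_integral_toReal_smul hgm.ennreal_ofReal
          (ae_of_all _ fun _ => ENNReal.ofReal_lt_top)]
        refine integral_congr_ae ?_
        filter_upwards [hg0] with ω hω
        rw [ENNReal.toReal_ofReal hω, smul_eq_mul]
    _ = ∫ x, x i ∂((μ.withDensity fun ω => ENNReal.ofReal (g ω)).map W) :=
        (integral_map hW.aemeasurable (measurable_pi_apply i).aestronglyMeasurable).symm
    _ = ∫ ω in A, W ω i ∂μ := by
        rw [← hmeas]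
        exact integral_map hW.aemeasurable (measurable_pi_apply i).aestronglyMeasurable

/-- The conditional distribution function of `W + r` when `W` is measurable with respect to the
conditioning σ-algebra and `r` is independent of it. -/
theorem condExp_Iic_add_of_indep (hm : m ≤ m0) {W r : Ω → Fin d → ℝ} (hW : Measurable[m] W)
    (hr : Measurable[m0] r) (hind : Indep (MeasurableSpace.comap r inferInstance) m μ)
    (ξ : Fin d → ℝ) :
    (fun ω => (μ.map r).real {x | W ω + x ≤ ξ}) =ᵐ[μ]
      μ[{ω | ∀ i, (W ω + r ω) i ≤ ξ i}.indicator fun _ => (1 : ℝ) | m] := by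
  have hW0 : Measurable[m0] W := hW.mono hm le_rfl
  have : IsProbabilityMeasure (μ.map r) := Measure.isProbabilityMeasure_map hr.aemeasurable
  have hD : MeasurableSet {q : (Fin d → ℝ) × (Fin d → ℝ) | q.1 + q.2 ≤ ξ} :=
    measurableSet_le (measurable_fst.add measurable_snd) measurable_const
  have hφ : Measurable fun w : Fin d → ℝ => (μ.map r).real {x | w + x ≤ ξ} :=
    (measurable_measure_prodMk_left hD).ennreal_toReal
  have hB : MeasurableSet {ω | ∀ i, (W ω + r ω) i ≤ ξ i} :=
    measurableSet_le (hW0.add hr) measurable_const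
  have hint : Integrable (fun ω => (μ.map r).real {x | W ω + x ≤ ξ}) μ := by
    refine Integrable.of_bound (hφ.comp hW0).aestronglyMeasurable 1 (ae_of_all _ fun ω => ?_)
    rw [Real.norm_of_nonneg measureReal_nonneg]
    exact measureReal_le_one
  refine ae_eq_condExp_of_forall_setIntegral_eq hm ((integrable_const 1).indicator hB)
    (fun _ _ _ => hint.integrableOn) (fun A hA _ => ?_)
    (hφ.comp hW).stronglyMeasurable.aestronglyMeasurable
  have hA0 : MeasurableSet A := hm A hA
  -- Pairing `W` with the indicator of the test set `A` gives an `m`-measurable variable independent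
  -- of `r`, so the set integral can be computed by Fubini under the product law.
  let V : Ω → ℝ × (Fin d → ℝ) := fun ω => (A.indicator (fun _ => 1) ω, W ω)
  have hV : Measurable[m] V := (measurable_const.indicator hA).prodMk hW
  have hV0 : Measurable[m0] V := hV.mono hm le_rfl
  have hVr : IndepFun V r μ :=
    (IndepFun_iff_Indep V r μ).2 (indep_of_indep_of_le_left hind.symm hV.comap_le)
  have hmap := (indepFun_iff_map_prod_eq_prod_map_map hV0.aemeasurable hr.aemeasurable).1 hVr
  let F : (ℝ × (Fin d → ℝ)) × (Fin d → ℝ) → ℝ := fun p =>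
    p.1.1 * {q : (Fin d → ℝ) × (Fin d → ℝ) | q.1 + q.2 ≤ ξ}.indicator (fun _ => 1) (p.1.2, p.2)
  have hF : Measurable F := (measurable_fst.comp measurable_fst).mul
    ((measurable_const.indicator hD).comp
      ((measurable_snd.comp measurable_fst).prodMk measurable_snd))
  have hFi : Integrable F ((μ.map V).prod (μ.map r)) := by
    rw [← hmap, integrable_map_measure hF.aestronglyMeasurable (hV0.prodMk hr).aemeasurable]
    refine Integrable.of_bound (hF.comp (hV0.prodMk hr)).aestronglyMeasurable 1
      (ae_of_all _ fun ω => ?_)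
    by_cases h1 : ω ∈ A <;> by_cases h2 : W ω + r ω ≤ ξ <;> simp [F, V, h1, h2]
  have key : ∫ ω, F (V ω, r ω) ∂μ =
      ∫ ω, (V ω).1 * (μ.map r).real {x | (V ω).2 + x ≤ ξ} ∂μ := by
    rw [← integral_map (f := F) (hV0.prodMk hr).aemeasurable hF.aestronglyMeasurable, hmap,
      integral_prod _ hFi, ← integral_map (μ := μ) (φ := V)
        (f := fun v => v.1 * (μ.map r).real {x | v.2 + x ≤ ξ}) hV0.aemeasurable
        (measurable_fst.mul (hφ.comp measurable_snd)).aestronglyMeasurable]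
    refine integral_congr_ae (ae_of_all _ fun v => ?_)
    simp only [F]
    rw [integral_const_mul]
    congr 1
    have hD' : MeasurableSet {x : Fin d → ℝ | v.2 + x ≤ ξ} := measurable_prodMk_left hD
    rw [← integral_indicator_one hD']
    rfl
  rw [← integral_indicator hA0, ← integral_indicator hA0]
  convert key.symm using 2 with ω ω
  · ext ω
    by_cases h : ω ∈ A <;> simp [V, h]
  · ext ω
    by_cases h : ω ∈ A
    · simp only [h, Set.indicator_of_mem, F, V, one_mul]
      rfl
    · simp [F, V, h]

end CondExp

/-! ### Generated σ-algebras. -/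

section SigmaOf

variable {Ω : Type*} {d : ℕ} {S S' : Finset ℕ} {Z : RandSeq Ω d}

theorem measurable_sigmaOf {k : ℕ} (hk : k ∈ S) : Measurable[sigmaOf Z S] (Z k) :=
  Measurable.of_comap_le (le_iSup₂_of_le k hk le_rfl)

theorem sigmaOf_mono (h : S' ⊆ S) : sigmaOf Z S' ≤ sigmaOf Z S :=
  iSup₂_le fun k hk => le_iSup₂_of_le k (h hk) le_rfl

end SigmaOf

/-! ### Equality of conditional distribution functions as vanishing of covariances. -/

section CondDistFun

variable {Ω : Type*} [MeasurableSpace Ω] {μ : Measure Ω} {d : ℕ} {T S S' : Finset ℕ}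
  {Z : RandSeq Ω d}

theorem IsNG.sigmaOf_le (hZ : IsNG μ T Z) (hS : S ⊆ T) : sigmaOf Z S ≤ ‹MeasurableSpace Ω› :=
  iSup₂_le fun k hk => (hZ.measurable k (hS hk)).comap_le

/-- An affine function of an NG sequence that is uncorrelated with some of the terms is
independent of them. -/
theorem IsNG.indep_sigmaOf (hZ : IsNG μ T Z) (hS : S ⊆ T) {r : Ω → Fin d → ℝ}
    (hr : AffineIn T Z r) (h0 : ∀ s ∈ S, covMat μ r (Z s) = 0) :
    Indep (MeasurableSpace.comap r inferInstance) (sigmaOf Z S) μ := by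
  obtain ⟨A, b, h⟩ := hr
  -- The linear part of `r` stacked with the conditioning terms: the pair is jointly Gaussian, so
  -- zero covariance yields independence.
  let L : (T → Fin d → ℝ) →ₗ[ℝ] (Fin d → ℝ) × (S × Fin d → ℝ) :=
    LinearMap.prod (∑ i : T, (Matrix.mulVecLin (A i)).comp (LinearMap.proj i))
      (LinearMap.pi fun p => (LinearMap.proj p.2 : (Fin d → ℝ) →ₗ[ℝ] ℝ).comp
        (LinearMap.proj (⟨p.1, hS p.1.2⟩ : T)))
  have hG : HasGaussianLaw (fun ω => ((fun i => r ω i), fun p : S × Fin d => Z p.1 ω p.2)) μ := by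
    refine (hasGaussianLaw_affine hZ.gaussian L (b, 0)).congr (ae_of_all _ fun ω => ?_)
    refine Prod.ext ?_ ?_
    · change (L fun k => Z k ω).1 + b = r ω
      rw [h ω, ← Finset.sum_coe_sort T (fun i => A i *ᵥ Z i ω)]
      simp [L]
    · ext p
      simp [L]
  have hind := hG.indepFun_of_covariance_eval (X := fun i ω => r ω i)
    (Y := fun (p : S × Fin d) ω => Z p.1 ω p.2)
    fun i p => congrFun (congrFun (h0 p.1 p.1.2) i) p.2
  refine indep_of_indep_of_le_right ((IndepFun_iff_Indep _ _ _).1 hind) ?_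
  refine iSup₂_le fun k hk => ?_
  let g : (S × Fin d → ℝ) → Fin d → ℝ := fun x i => x (⟨k, hk⟩, i)
  have hg : Measurable g := measurable_pi_iff.2 fun i => measurable_pi_apply _
  change MeasurableSpace.comap (g ∘ fun ω (p : S × Fin d) => Z p.1 ω p.2) _ ≤ _
  rw [← MeasurableSpace.comap_comp]
  exact MeasurableSpace.comap_mono hg.comap_le

variable [IsProbabilityMeasure μ]

/-- The residual `Z k - W` is independent of both σ-algebras and `W` is measurable for both, so both
conditional distribution functions are the same function of `W`. -/
theorem IsNG.condDistFun_congr (hZ : IsNG μ T Z) (hSS : S' ⊆ S) (hS : S ⊆ T) {k : ℕ} (hk : k ∈ T)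
    {W : Ω → Fin d → ℝ} (hW : AffineIn S' Z W)
    (h0 : ∀ s ∈ S, covMat μ (fun ω => Z k ω - W ω) (Z s) = 0) (ξ : Fin d → ℝ) :
    condDistFun μ Z k ξ S =ᵐ[μ] condDistFun μ Z k ξ S' := by
  have hWT : AffineIn T Z W := hW.mono (hSS.trans hS)
  have hr : AffineIn T Z fun ω => Z k ω - W ω := (AffineIn.self hk).sub hWT
  have hrm : Measurable fun ω => Z k ω - W ω := hr.measurable hZ.measurable
  have h1 := condExp_Iic_add_of_indep (hZ.sigmaOf_le hS)
    ((hW.mono hSS).measurable fun i hi => measurable_sigmaOf hi) hrm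
    (hZ.indep_sigmaOf hS hr h0) ξ
  have h2 := condExp_Iic_add_of_indep (hZ.sigmaOf_le (hSS.trans hS))
    (hW.measurable fun i hi => measurable_sigmaOf hi) hrm
    (hZ.indep_sigmaOf (hSS.trans hS) hr fun s hs => h0 s (hSS hs)) ξ
  simp only [add_sub_cancel] at h1 h2
  exact h1.symm.trans h2

/-- Regress `Z k` on `S'`. The residual is independent of `S'`, so its conditional mean given `S'`
is constant; the hypothesis carries this over to `S`, and a variable with constant conditional mean
given `S` is uncorrelated with every term of `S`. -/
theorem IsNG.exists_regression_of_condDistFun_congr (hZ : IsNG μ T Z) (hSS : S' ⊆ S) (hS : S ⊆ T)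
    {k : ℕ} (hk : k ∈ T)
    (h : ∀ ξ, condDistFun μ Z k ξ S =ᵐ[μ] condDistFun μ Z k ξ S') :
    ∃ G : ℕ → Matrix (Fin d) (Fin d) ℝ,
      ∀ s ∈ S, covMat μ (fun ω => Z k ω - ∑ i ∈ S', G i *ᵥ Z i ω) (Z s) = 0 := by
  obtain ⟨G, hG⟩ := (hZ.subset (hSS.trans hS)).exists_regression (hZ.memLp hk)
  refine ⟨G, fun s hs => ?_⟩
  set W : Ω → Fin d → ℝ := fun ω => ∑ i ∈ S', G i *ᵥ Z i ω with hWdef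
  have hW : AffineIn S' Z W := AffineIn.sum fun i hi => (AffineIn.self hi).mulVec (G i)
  have hr : AffineIn T Z fun ω => Z k ω - W ω :=
    (AffineIn.self hk).sub (hW.mono (hSS.trans hS))
  have hle := hZ.sigmaOf_le hS
  have hle' := hZ.sigmaOf_le (hSS.trans hS)
  have hk2 := hZ.memLp hk
  have hW2 : MemLp W 2 μ := hW.memLp fun i hi => hZ.memLp (hS (hSS hi))
  have hr2 : MemLp (fun ω => Z k ω - W ω) 2 μ := hk2.sub hW2
  have hs2 := hZ.memLp (hS hs)
  have hWm : Measurable[sigmaOf Z S'] W := hW.measurable fun i hi => measurable_sigmaOf hi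
  ext i j
  have hki : Integrable (fun ω => Z k ω i) μ := (hk2.eval i).integrable one_le_two
  have hWi : Integrable (fun ω => W ω i) μ := (hW2.eval i).integrable one_le_two
  have hri : Integrable (fun ω => (Z k ω - W ω) i) μ := (hr2.eval i).integrable one_le_two
  have hWim : StronglyMeasurable[sigmaOf Z S'] fun ω => W ω i :=
    ((measurable_pi_apply i).comp hWm).stronglyMeasurable
  have hcong := condExp_eval_congr_of_condExp_Iic (sigmaOf_mono hSS) hle (hZ.measurable k hk)
    (hk2.integrable one_le_two) h i
  have hconst : μ[fun ω => (Z k ω - W ω) i | sigmaOf Z S'] =ᵐ[μ]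
      fun _ => ∫ ω, (Z k ω - W ω) i ∂μ := by
    refine condExp_indep_eq (m₁ := MeasurableSpace.comap (fun ω => Z k ω - W ω) inferInstance)
      (hr.measurable hZ.measurable).comap_le hle' ?_ (hZ.indep_sigmaOf (hSS.trans hS) hr hG)
    exact Measurable.stronglyMeasurable (f := (fun x : Fin d → ℝ => x i) ∘ fun ω => Z k ω - W ω)
      ((measurable_pi_apply i).comp (comap_measurable _))
  have hconstS : μ[fun ω => (Z k ω - W ω) i | sigmaOf Z S] =ᵐ[μ]
      fun _ => ∫ ω, (Z k ω - W ω) i ∂μ := by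
    have h1 : μ[fun ω => (Z k ω - W ω) i | sigmaOf Z S] =ᵐ[μ] _ := condExp_sub hki hWi _
    have h2 : μ[fun ω => (Z k ω - W ω) i | sigmaOf Z S'] =ᵐ[μ] _ := condExp_sub hki hWi _
    rw [condExp_of_stronglyMeasurable hle (hWim.mono (sigmaOf_mono hSS)) hWi] at h1
    rw [condExp_of_stronglyMeasurable hle' hWim hWi] at h2
    filter_upwards [h1, h2, hcong, hconst] with ω e1 e2 e3 e4
    rw [e1, ← e4, e2, Pi.sub_apply, Pi.sub_apply, e3]
  have hrs : Integrable ((fun ω => Z s ω j) * fun ω => (Z k ω - W ω) i) μ :=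
    (hs2.eval j).integrable_mul (hr2.eval i)
  have hpull := condExp_mul_of_stronglyMeasurable_left (m := sigmaOf Z S)
    (f := fun ω => Z s ω j) ((measurable_pi_apply j).comp (measurable_sigmaOf hs)).stronglyMeasurable hrs hri
  change covariance (fun ω => (Z k ω - W ω) i) (fun ω => Z s ω j) μ = 0
  rw [covariance_comm, covariance_eq_sub (hs2.eval j) (hr2.eval i), ← integral_condExp hle,
    integral_congr_ae hpull, sub_eq_zero]
  have : (fun ω => Z s ω j) * μ[fun ω => (Z k ω - W ω) i | sigmaOf Z S] =ᵐ[μ]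
      fun ω => Z s ω j * ∫ ω, (Z k ω - W ω) i ∂μ := by
    filter_upwards [hconstS] with ω hω
    rw [Pi.mul_apply, hω]
  exact (integral_congr_ae this).trans (integral_mul_const _ _)

end CondDistFun

end CMSeq

namespace CMSeq

/-! ### White noise and uniqueness of Markov models. -/

section Models

variable {Ω : Type*} [MeasurableSpace Ω] {μ : Measure Ω} {d : ℕ}

theorem integral_mulVec {U : Ω → Fin d → ℝ} (hU : Integrable U μ)
    (A : Matrix (Fin d) (Fin d) ℝ) : ∫ ω, A *ᵥ U ω ∂μ = A *ᵥ ∫ ω, U ω ∂μ :=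
  (Matrix.mulVecLin A).toContinuousLinearMap.integral_comp_comm hU

theorem IsWhiteNG.subset {T S : Finset ℕ} [IsProbabilityMeasure μ] {e : RandSeq Ω d}
    {Q : ℕ → Matrix (Fin d) (Fin d) ℝ} (h : IsWhiteNG μ T e Q) (hS : S ⊆ T) :
    IsWhiteNG μ S e Q where
  ng := h.ng.subset hS
  zero_mean k hk := h.zero_mean k (hS hk)
  white j hj k hk := h.white j (hS hj) k (hS hk)
  cov_eq k hk := h.cov_eq k (hS hk)

theorem IsMarkovModel.congr {T : Finset ℕ} {Z : RandSeq Ω d}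
    {U U' : ℕ → ℕ → Matrix (Fin d) (Fin d) ℝ} {R R' : ℕ → Matrix (Fin d) (Fin d) ℝ}
    (h : IsMarkovModel μ T Z U R) (hU : ∀ k, k ∈ T → k + 1 ∈ T → U' (k + 1) k = U (k + 1) k)
    (hR : ∀ k ∈ T, R' k = R k) : IsMarkovModel μ T Z U' R' := by
  obtain ⟨e, he, h1, h2⟩ := h
  refine ⟨e, ⟨he.ng, he.zero_mean, he.white, fun k hk => ?_⟩, fun k hk hk' => ?_, h2⟩
  · rw [he.cov_eq k hk, hR k hk]
  · rw [hU k hk hk']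
    exact h1 k hk hk'

variable [IsProbabilityMeasure μ]

/-- Taking covariances with `V` leaves `M * Cov(V) = 0`. Every identification of model coefficients
below reduces to this. -/
theorem coeff_eq_zero {W r V : Ω → Fin d → ℝ} {M : Matrix (Fin d) (Fin d) ℝ}
    (hr : MemLp r 2 μ) (hV : MemLp V 2 μ) (h : W =ᵐ[μ] fun ω => r ω + M *ᵥ V ω)
    (hW0 : covMat μ W V = 0) (hr0 : covMat μ r V = 0) (hdet : (covMat μ V V).det ≠ 0) :
    M = 0 := by
  refine eq_zero_of_mul_det_ne_zero hdet ?_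
  rw [covMat_congr_ae h (ae_eq_refl V), covMat_add_left hr (memLp_mulVec hV M) hV, hr0, zero_add,
    covMat_mulVec_left hV hV] at hW0
  exact hW0

/-- Unrolling the recursion expresses `Z k` through noises at times up to `k`, all uncorrelated with
later noise. -/
theorem covMat_noise_eq_zero {T : Finset ℕ} {Z e : RandSeq Ω d}
    {U : ℕ → ℕ → Matrix (Fin d) (Fin d) ℝ} {R : ℕ → Matrix (Fin d) (Fin d) ℝ}
    (hT : ∀ k ∈ T, (∀ j ∈ T, k ≤ j) ∨ ∃ j ∈ T, k = j + 1) (hZ : ∀ k ∈ T, MemLp (Z k) 2 μ)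
    (he : IsWhiteNG μ T e R)
    (h1 : ∀ k, k ∈ T → k + 1 ∈ T →
      Z (k + 1) =ᵐ[μ] fun ω => U (k + 1) k *ᵥ Z k ω + e (k + 1) ω)
    (h2 : ∀ k ∈ T, (∀ j ∈ T, k ≤ j) → Z k =ᵐ[μ] e k) {k m : ℕ} (hk : k ∈ T) (hm : m ∈ T)
    (hkm : k < m) : covMat μ (Z k) (e m) = 0 := by
  induction k with
  | zero =>
    rw [covMat_congr_ae (h2 0 hk fun j _ => Nat.zero_le j) (ae_eq_refl _)]
    exact he.white 0 hk m hm hkm.ne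
  | succ k ih =>
    rcases hT _ hk with h | ⟨j, hj, hkj⟩
    · rw [covMat_congr_ae (h2 _ hk h) (ae_eq_refl _)]
      exact he.white _ hk m hm hkm.ne
    · obtain rfl : k = j := Nat.succ_injective hkj
      rw [covMat_congr_ae (h1 k hj hk) (ae_eq_refl _),
        covMat_add_left (memLp_mulVec (hZ k hj) _) (he.ng.memLp hk) (he.ng.memLp hm),
        covMat_mulVec_left (hZ k hj) (he.ng.memLp hm), ih hj (by omega),
        he.white _ hk m hm hkm.ne, mul_zero, add_zero]

/-- A sequence with nonsingular covariances has at most one Markov model. -/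
theorem IsMarkovModel.unique {T : Finset ℕ} {Z : RandSeq Ω d}
    {U U' : ℕ → ℕ → Matrix (Fin d) (Fin d) ℝ} {R R' : ℕ → Matrix (Fin d) (Fin d) ℝ}
    (hT : ∀ k ∈ T, (∀ j ∈ T, k ≤ j) ∨ ∃ j ∈ T, k = j + 1) (hZ : ∀ k ∈ T, MemLp (Z k) 2 μ)
    (hdet : ∀ k ∈ T, (covMat μ (Z k) (Z k)).det ≠ 0)
    (h : IsMarkovModel μ T Z U R) (h' : IsMarkovModel μ T Z U' R') :
    (∀ k, k ∈ T → k + 1 ∈ T → U (k + 1) k = U' (k + 1) k) ∧ ∀ k ∈ T, R k = R' k := by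
  obtain ⟨e, he, h1, h2⟩ := h
  obtain ⟨e', he', h1', h2'⟩ := h'
  have hU : ∀ k, k ∈ T → k + 1 ∈ T → U (k + 1) k = U' (k + 1) k := by
    intro k hk hk'
    rw [← sub_eq_zero]
    refine coeff_eq_zero (W := e' (k + 1)) (he.ng.memLp hk') (hZ k hk) ?_
      (covMat_eq_zero_comm.1 (covMat_noise_eq_zero hT hZ he' h1' h2' hk hk' k.lt_succ_self))
      (covMat_eq_zero_comm.1 (covMat_noise_eq_zero hT hZ he h1 h2 hk hk' k.lt_succ_self))
      (hdet k hk)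
    filter_upwards [h1 k hk hk', h1' k hk hk'] with ω e1 e2
    rw [e1] at e2
    rw [Matrix.sub_mulVec, add_sub, add_comm (e (k + 1) ω), e2, add_sub_cancel_left]
  refine ⟨hU, fun k hk => ?_⟩
  have hee : e k =ᵐ[μ] e' k := by
    rcases hT k hk with hmin | ⟨j, hj, rfl⟩
    · exact (h2 k hk hmin).symm.trans (h2' k hk hmin)
    · filter_upwards [h1 j hj hk, h1' j hj hk] with ω e1 e2
      rw [e1, hU j hj hk] at e2
      exact add_left_cancel e2
  rw [← he.cov_eq k hk, ← he'.cov_eq k hk, covMat_congr_ae hee hee]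

end Models

/-! ### Markov-based representations and $CM_c$ models. -/

section Representation

variable {Ω : Type*} [MeasurableSpace Ω] {μ : Measure Ω} {d N c : ℕ}
  {X Y : RandSeq Ω d}

theorem mem_timesOff {k : ℕ} : k ∈ timesOff N c ↔ k ≠ c ∧ k ≤ N := by
  simp [timesOff]

theorem timesOff_subset : timesOff N c ⊆ Finset.Icc 0 N :=
  Finset.erase_subset _ _

/-- Removing an endpoint of `[0,N]` leaves an interval; this is where `c ∈ {0,N}` matters for the
Markov recursion. -/
theorem timesOff_interval (hc : c = 0 ∨ c = N) (k : ℕ) (hk : k ∈ timesOff N c) :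
    (∀ j ∈ timesOff N c, k ≤ j) ∨ ∃ j ∈ timesOff N c, k = j + 1 := by
  simp only [mem_timesOff] at *
  by_cases h : k = 0 ∨ k - 1 = c
  · left
    omega
  · right
    exact ⟨k - 1, by omega⟩

variable [IsProbabilityMeasure μ]

/-- The regression matrix of `X k` on `X c`. -/
noncomputable def gain (μ : Measure Ω) (X : RandSeq Ω d) (c k : ℕ) : Matrix (Fin d) (Fin d) ℝ :=
  covMat μ (X k) (X c) * (covMat μ (X c) (X c))⁻¹

theorem covMat_sub_gain (hk : MemLp (X k) 2 μ) (hc : MemLp (X c) 2 μ)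
    (hdet : (covMat μ (X c) (X c)).det ≠ 0) :
    covMat μ (fun ω => X k ω - gain μ X c k *ᵥ X c ω) (X c) = 0 := by
  rw [covMat_sub_left hk (memLp_mulVec hc _) hc, covMat_mulVec_left hc hc, gain,
    Matrix.nonsing_inv_mul_cancel_right _ _ hdet.isUnit, sub_self]

theorem IsNG.sub_mulVec (hX : IsNG μ (Finset.Icc 0 N) X) (hcN : c ∈ Finset.Icc 0 N)
    (Γ : ℕ → Matrix (Fin d) (Fin d) ℝ) :
    IsNG μ (timesOff N c) fun k ω => X k ω - Γ k *ᵥ X c ω := by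
  have haff : ∀ k ∈ timesOff N c, AffineIn (Finset.Icc 0 N) X fun ω => X k ω - Γ k *ᵥ X c ω :=
    fun k hk => (AffineIn.self (timesOff_subset hk)).sub ((AffineIn.self hcN).mulVec _)
  refine ⟨fun k hk => (haff k hk).measurable hX.measurable,
    hX.hasGaussianLaw_of_affineIn fun k : timesOff N c => haff k k.2, ?_⟩
  refine (det_blockCov_ne_zero_iff fun k hk =>
    (haff k hk).memLp fun i hi => hX.memLp hi).2 fun v a hv k hk => ?_
  have := hX.eq_zero_of_sum_ae_const
    -- Expanding `∑ v i ⬝ᵥ (X i - Γ i *ᵥ X c)` leaves `v` at the times other than `c` and collects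
    -- the rest at `c`.
    (v := fun k => if k = c then -∑ i ∈ timesOff N c, v i ᵥ* Γ i else v k) (a := a) (by
      filter_upwards [hv] with ω hω
      rw [← hω, ← Finset.add_sum_erase _ _ hcN]
      rw [Finset.sum_congr rfl (g := fun i => v i ⬝ᵥ X i ω)]
      · simp only [if_true, neg_dotProduct, sum_dotProduct, dotProduct_sub,
          Finset.sum_sub_distrib, Matrix.dotProduct_mulVec, timesOff]
        ring
      · intro i hi
        simp [Finset.ne_of_mem_erase hi]) (timesOff_subset hk)
  simpa [(mem_timesOff.1 hk).1] using this

/-- In a `CM_c` sequence, the residual of `X k` on `X j`, `X c` is uncorrelated with the past and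
`X c`. -/
theorem IsCM.exists_regression (hX : IsNG μ (Finset.Icc 0 N) X) (hCM : IsCM μ N c X)
    (hcN : c ∈ Finset.Icc 0 N) {j k : ℕ} (hjc : j ≠ c) (hk : k ≤ N) (hjk : j < k) :
    ∃ A B : Matrix (Fin d) (Fin d) ℝ, ∀ s ∈ insert c (Finset.Icc 0 j),
      covMat μ (fun ω => X k ω - (A *ᵥ X j ω + B *ᵥ X c ω)) (X s) = 0 := by
  have hkm : k ∈ Finset.Icc 0 N := by simpa using hk
  have hjm : j ∈ Finset.Icc 0 N := by simpa using (hjk.trans_le hk).le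
  have hSS : ({j, c} : Finset ℕ) ⊆ insert c (Finset.Icc 0 j) := by
    intro i hi
    simp only [Finset.mem_insert, Finset.mem_singleton, Finset.mem_Icc] at *
    omega
  have hS : insert c (Finset.Icc 0 j) ⊆ Finset.Icc 0 N := by
    intro i hi
    simp only [Finset.mem_insert, Finset.mem_Icc] at *
    omega
  obtain ⟨G, hG⟩ := hX.exists_regression_of_condDistFun_congr hSS hS hkm
    (hCM j hjm k hkm hjk)
  refine ⟨G j, G c, fun s hs => ?_⟩
  have := hG s hs
  simpa only [Finset.sum_pair hjc] using this

theorem exists_isMarkovRep (hX : IsNG μ (Finset.Icc 0 N) X) (hCM : IsCM μ N c X)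
    (hcN : c ∈ Finset.Icc 0 N) :
    IsMarkovRep μ N c X (fun k ω => X k ω - gain μ X c k *ᵥ X c ω) (gain μ X c) := by
  set Γ := gain μ X c
  set Y : RandSeq Ω d := fun k ω => X k ω - Γ k *ᵥ X c ω with hY
  have hYng : IsNG μ (timesOff N c) Y := hX.sub_mulVec hcN Γ
  have hdet := hX.det_covMat_ne_zero hcN
  have hc2 := hX.memLp hcN
  have hunc : ∀ k ∈ timesOff N c, covMat μ (Y k) (X c) = 0 :=
    fun k hk => covMat_sub_gain (hX.memLp (timesOff_subset hk)) hc2 hdet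
  refine ⟨hYng, fun j hj k hk hjk => ?_, hX.subset (Finset.singleton_subset_iff.2 hcN), hunc,
    fun k _ => ae_of_all _ fun ω => by simp [hY]⟩
  obtain ⟨A, B, hAB⟩ := IsCM.exists_regression hX hCM hcN (mem_timesOff.1 hj).1
    (mem_timesOff.1 hk).2 hjk
  set r : Ω → Fin d → ℝ := fun ω => X k ω - (A *ᵥ X j ω + B *ᵥ X c ω) with hr
  have hj2 := hX.memLp (timesOff_subset hj)
  have hr2 : MemLp r 2 μ := (hX.memLp (timesOff_subset hk)).sub
    ((memLp_mulVec hj2 A).add (memLp_mulVec hc2 B))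
  have hYj2 := hYng.memLp hj
  have heq : ∀ ω, Y k ω - A *ᵥ Y j ω = r ω + (A * Γ j + B - Γ k) *ᵥ X c ω := by
    intro ω
    simp only [hY, hr, Matrix.add_mulVec, Matrix.sub_mulVec, Matrix.mulVec_sub,
      Matrix.mulVec_mulVec]
    abel
  -- `Y k`, `Y j` and `r` are all uncorrelated with `X c`, so `X c` cannot occur; hence `r` is also
  -- the residual of `Y k` on `Y j`.
  have hM : A * Γ j + B - Γ k = 0 := by
    refine coeff_eq_zero hr2 hc2 (ae_of_all _ heq) ?_ (hAB c (by simp)) hdet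
    rw [covMat_sub_left (hYng.memLp hk) (memLp_mulVec hYj2 A) hc2, covMat_mulVec_left hYj2 hc2,
      hunc k hk, hunc j hj, mul_zero, sub_zero]
  refine hYng.condDistFun_congr (W := fun ω => A *ᵥ Y j ω) (T := timesOff N c) ?_
    (Finset.filter_subset _ _) hk ((AffineIn.self (by simp)).mulVec A) fun s hs => ?_
  · simpa using hj
  · rw [Finset.mem_filter] at hs
    have hYk : (fun ω => Y k ω - A *ᵥ Y j ω) = r := by
      funext ω
      rw [heq ω, hM, Matrix.zero_mulVec, add_zero]
    rw [hYk, covMat_eq_zero_comm]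
    have haff : AffineIn (insert c (Finset.Icc 0 j)) X (Y s) :=
      (AffineIn.self (by simp [hs.2])).sub ((AffineIn.self (by simp)).mulVec _)
    refine haff.covMat_eq_zero (fun i hi => hX.memLp ?_) hr2 fun i hi =>
      covMat_eq_zero_comm.1 (hAB i hi)
    have := mem_timesOff.1 hj
    simp only [Finset.mem_insert, Finset.mem_Icc] at hi hcN ⊢
    omega

theorem IsMarkovRep.covMat_eq {Γ : ℕ → Matrix (Fin d) (Fin d) ℝ} (h : IsMarkovRep μ N c X Y Γ)
    {k : ℕ} (hk : k ∈ timesOff N c) :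
    covMat μ (X k) (X c) = Γ k * covMat μ (X c) (X c) := by
  have hc2 := h.ng_c.memLp (Finset.mem_singleton_self c)
  rw [covMat_congr_ae (h.eq k hk) (ae_eq_refl _),
    covMat_add_left (h.ng.memLp hk) (memLp_mulVec hc2 _) hc2, h.uncorrelated k hk,
    covMat_mulVec_left hc2 hc2, zero_add]

theorem IsMarkovRep.unique {Y' : RandSeq Ω d} {Γ Γ' : ℕ → Matrix (Fin d) (Fin d) ℝ}
    (h : IsMarkovRep μ N c X Y Γ) (h' : IsMarkovRep μ N c X Y' Γ') {k : ℕ}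
    (hk : k ∈ timesOff N c) : Y k =ᵐ[μ] Y' k ∧ Γ k = Γ' k := by
  have hΓ : Γ k = Γ' k := by
    refine sub_eq_zero.1 (eq_zero_of_mul_det_ne_zero
      (h.ng_c.det_covMat_ne_zero (Finset.mem_singleton_self c)) ?_)
    rw [sub_mul, ← h.covMat_eq hk, ← h'.covMat_eq hk, sub_self]
  refine ⟨?_, hΓ⟩
  filter_upwards [h.eq k hk, h'.eq k hk] with ω e1 e2
  rw [e1, hΓ] at e2
  exact add_right_cancel e2

/-- One step of the recursion of a `CM_c` sequence; at the first time outside `c` there is no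
dependence on the previous time. -/
theorem IsCM.exists_step (hX : IsNG μ (Finset.Icc 0 N) X) (hCM : IsCM μ N c X)
    (hc : c = 0 ∨ c = N) (k : ℕ) :
    ∃ A B : Matrix (Fin d) (Fin d) ℝ, (k = 0 ∨ k - 1 = c → A = 0) ∧ (k ∈ timesOff N c →
      ∀ s ∈ Finset.Icc 0 N, s = c ∨ s < k →
        covMat μ (fun ω => X k ω - (A *ᵥ X (k - 1) ω + B *ᵥ X c ω)) (X s) = 0) := by
  have hcN : c ∈ Finset.Icc 0 N := by
    simp only [Finset.mem_Icc]
    omega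
  by_cases hfirst : k = 0 ∨ k - 1 = c
  · refine ⟨0, gain μ X c k, fun _ => rfl, fun hk s hs hsk => ?_⟩
    obtain rfl : s = c := by
      simp only [mem_timesOff, Finset.mem_Icc] at *
      omega
    simpa using covMat_sub_gain (hX.memLp (timesOff_subset hk)) (hX.memLp hcN)
      (hX.det_covMat_ne_zero hcN)
  · push Not at hfirst
    by_cases hk : k ∈ timesOff N c
    · obtain ⟨A, B, h⟩ := IsCM.exists_regression hX hCM hcN hfirst.2 (mem_timesOff.1 hk).2
        (by omega : k - 1 < k)
      refine ⟨A, B, fun h' => by omega, fun _ s hs hsk => h s ?_⟩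
      simp only [Finset.mem_insert, Finset.mem_Icc]
      omega
    · exact ⟨0, 0, fun _ => rfl, fun h => absurd h hk⟩

theorem exists_isCMModel (hN : 1 ≤ N) (hX : IsNG μ (Finset.Icc 0 N) X) (hCM : IsCM μ N c X)
    (hc : c = 0 ∨ c = N) : ∃ (G : ℕ → ℕ → Matrix (Fin d) (Fin d) ℝ)
      (Q : ℕ → Matrix (Fin d) (Fin d) ℝ), IsCMModel μ N c (centered μ X) G Q := by
  have hcN : c ∈ Finset.Icc 0 N := by
    simp only [Finset.mem_Icc]
    omega
  choose A B hA hAB using IsCM.exists_step hX hCM hc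
  -- `V k` is the one-step predictor and `W k` the innovation; a zero predictor at `c` encodes the
  -- boundary condition `W c = X c`.
  let V : RandSeq Ω d := fun k ω =>
    if k = c then 0 else A k *ᵥ X (k - 1) ω + B k *ᵥ X c ω
  let W : RandSeq Ω d := fun k ω => X k ω - V k ω
  have hWc : W c = X c := by
    funext ω
    simp [W, V]
  have hW : ∀ k, k ≠ c → W k = fun ω => X k ω - (A k *ᵥ X (k - 1) ω + B k *ᵥ X c ω) := by
    intro k hk
    funext ω
    simp [W, V, hk]
  have hVaff : ∀ k ∈ Finset.Icc 0 N,
      AffineIn ((insert c (Finset.Icc 0 k)).erase k) X (V k) := by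
    intro k hk
    by_cases hkc : k = c
    · simpa [V, hkc] using AffineIn.const (0 : Fin d → ℝ)
    · simp only [V, hkc, if_false]
      refine AffineIn.add ?_ ((AffineIn.self ?_).mulVec _)
      -- At `k = 0` truncated subtraction makes `X (k - 1)` equal to `X k` itself, so the predictor
      -- avoids `X k` only because `A 0 = 0`.
      · by_cases h0 : k = 0
        · simpa [hA k (Or.inl h0)] using AffineIn.const (0 : Fin d → ℝ)
        · refine (AffineIn.self ?_).mulVec _
          simp only [Finset.mem_erase, Finset.mem_insert, Finset.mem_Icc]
          omega
      · exact Finset.mem_erase.2 ⟨Ne.symm hkc, Finset.mem_insert_self _ _⟩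
  have hins : ∀ k ∈ Finset.Icc 0 N, insert c (Finset.Icc 0 k) ⊆ Finset.Icc 0 N := by
    intro k hk i hi
    simp only [Finset.mem_insert, Finset.mem_Icc] at *
    omega
  have hWpast : ∀ k ∈ Finset.Icc 0 N, AffineIn (insert c (Finset.Icc 0 k)) X (W k) :=
    fun k hk => (AffineIn.self (by simp)).sub ((hVaff k hk).mono (Finset.erase_subset _ _))
  have hWaff : ∀ k ∈ Finset.Icc 0 N, AffineIn (Finset.Icc 0 N) X (W k) :=
    fun k hk => (hWpast k hk).mono (hins k hk)
  have hW2 : ∀ k ∈ Finset.Icc 0 N, MemLp (W k) 2 μ :=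
    fun k hk => (hWaff k hk).memLp fun i hi => hX.memLp hi
  have hres : ∀ j ∈ Finset.Icc 0 N, ∀ k ∈ timesOff N c, j = c ∨ j < k →
      covMat μ (W j) (W k) = 0 := by
    intro j hj k hk hjk
    rw [covMat_eq_zero_comm, hW k (mem_timesOff.1 hk).1, covMat_eq_zero_comm]
    rcases hjk with rfl | hjk
    · rw [hWc, covMat_eq_zero_comm]
      exact hAB k hk j hj (Or.inl rfl)
    · refine (hWpast j hj).covMat_eq_zero (fun i hi => hX.memLp (hins j hj hi)) ?_ fun i hi => ?_
      · rw [← hW k (mem_timesOff.1 hk).1]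
        exact hW2 k (timesOff_subset hk)
      · rw [covMat_eq_zero_comm]
        refine hAB k hk i (hins j hj hi) ?_
        simp only [Finset.mem_insert, Finset.mem_Icc] at hi
        omega
  have hwhite : ∀ j ∈ Finset.Icc 0 N, ∀ k ∈ Finset.Icc 0 N, j ≠ k →
      covMat μ (W j) (W k) = 0 := by
    intro j hj k hk hjk
    -- Order the times with `c` first and the others increasingly: of two distinct innovations, the
    -- later one is uncorrelated with the earlier one.
    by_cases h : j = c ∨ (k ≠ c ∧ j < k)
    · refine hres j hj k (mem_timesOff.2 ?_) (by omega)
      simp only [Finset.mem_Icc] at hk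
      omega
    · rw [covMat_eq_zero_comm]
      refine hres k hk j (mem_timesOff.2 ?_) (by omega)
      simp only [Finset.mem_Icc] at hj
      omega
  have hcov : ∀ j ∈ Finset.Icc 0 N, ∀ k ∈ Finset.Icc 0 N,
      covMat μ (centered μ W j) (centered μ W k) = covMat μ (W j) (W k) := by
    intro j hj k hk
    rw [covMat_centered_left (hW2 j hj), covMat_centered_right (hW2 k hk)]
  have heaff : ∀ k ∈ Finset.Icc 0 N, AffineIn (Finset.Icc 0 N) X (centered μ W k) :=
    fun k hk => (hWaff k hk).sub (AffineIn.const _)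
  have hint : ∀ k, k ∈ Finset.Icc 0 N → Integrable (X k) μ :=
    fun k hk => (hX.memLp hk).integrable one_le_two
  have hstep : ∀ k ∈ timesOff N c, ∀ ω, centered μ X k ω =
      A k *ᵥ centered μ X (k - 1) ω + B k *ᵥ centered μ X c ω + centered μ W k ω := by
    intro k hk ω
    obtain ⟨hkc, hkN⟩ := mem_timesOff.1 hk
    have i1 := hint k (timesOff_subset hk)
    have i2 := hint (k - 1) (by simp only [Finset.mem_Icc]; omega)
    have i3 := hint c hcN
    have j2 : Integrable (fun ω => A k *ᵥ X (k - 1) ω) μ :=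
      (Matrix.mulVecLin (A k)).toContinuousLinearMap.integrable_comp i2
    have j3 : Integrable (fun ω => B k *ᵥ X c ω) μ :=
      (Matrix.mulVecLin (B k)).toContinuousLinearMap.integrable_comp i3
    have hWint : ∫ ω, W k ω ∂μ =
        ∫ ω, X k ω ∂μ - (A k *ᵥ ∫ ω, X (k - 1) ω ∂μ + B k *ᵥ ∫ ω, X c ω ∂μ) := by
      rw [hW k hkc, ← integral_mulVec i2, ← integral_mulVec i3, ← integral_add j2 j3]
      exact integral_sub i1 (j2.add j3)
    have hWω := congrFun (hW k hkc) ω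
    simp only [centered, hWint, hWω, Matrix.mulVec_sub]
    abel
  -- For `c = 0`, `k = 1` the entries `G k (k - 1)` and `G k c` coincide and are counted twice, so
  -- each carries half of `B k`.
  refine ⟨fun k j => if k - 1 = c then (2⁻¹ : ℝ) • B k else if j = c then B k else A k,
    fun k => covMat μ (W k) (W k), centered μ W, ⟨⟨?_, ?_, ?_⟩, ?_, ?_, ?_⟩, ?_, ?_, ?_⟩
  · exact fun k hk => (heaff k hk).measurable hX.measurable
  · exact hX.hasGaussianLaw_of_affineIn fun k : Finset.Icc 0 N => heaff k k.2
  · refine det_blockCov_ne_zero_of_white (fun j hj k hk hjk => ?_) fun k hk => ?_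
    · rw [hcov j hj k hk, hwhite j hj k hk hjk]
    · rw [hcov k hk k hk]
      exact hX.det_covMat_sub_ne_zero hk
        ((hVaff k hk).mono (Finset.erase_subset_erase _ (hins k hk)))
  · intro k hk
    simp only [centered]
    rw [integral_sub ((hW2 k hk).integrable one_le_two) (integrable_const _)]
    simp
  · intro j hj k hk hjk
    rw [hcov j hj k hk, hwhite j hj k hk hjk]
  · exact fun k hk => hcov k hk k hk
  · intro k hk
    simp only [Finset.mem_erase, Finset.mem_Icc] at hk
    refine ae_of_all _ fun ω => ?_
    rw [hstep k (mem_timesOff.2 ⟨hk.1, hk.2.2⟩) ω]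
    by_cases h : k - 1 = c
    · simp only [h, if_true, hA k (Or.inr h), Matrix.zero_mulVec, zero_add,
        ← Matrix.add_mulVec, ← add_smul]
      norm_num
    · simp [h]
  · refine ae_of_all _ fun ω => ?_
    simp only [centered, hWc]
  · intro hcN'
    refine ae_of_all _ fun ω => ?_
    rw [hstep 0 (mem_timesOff.2 (by omega)) ω, hA 0 (Or.inl rfl)]
    have h0 : 0 ≠ c := by omega
    simp [h0]

theorem IsMarkovRep.centered_ae_eq {Γ : ℕ → Matrix (Fin d) (Fin d) ℝ}
    (h : IsMarkovRep μ N c X Y Γ) {k : ℕ} (hk : k ∈ timesOff N c) :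
    centered μ X k =ᵐ[μ] fun ω => centered μ Y k ω + Γ k *ᵥ centered μ X c ω := by
  have hc1 := (h.ng_c.memLp (Finset.mem_singleton_self c)).integrable one_le_two
  have hk1 := (h.ng.memLp hk).integrable one_le_two
  have hΓ : Integrable (fun ω => Γ k *ᵥ X c ω) μ :=
    (Matrix.mulVecLin (Γ k)).toContinuousLinearMap.integrable_comp hc1
  filter_upwards [h.eq k hk] with ω hω
  simp only [centered]
  rw [integral_congr_ae (h.eq k hk), integral_add hk1 hΓ, integral_mulVec hc1, hω,
    Matrix.mulVec_sub]
  abel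

/-- The parameters of a `CM_c` model determine the matrices `Γ k` and a Markov model of the
underlying Markov sequence. -/
theorem IsCMModel.markovRep (hN : 1 ≤ N) (hc : c = 0 ∨ c = N)
    (hX : IsNG μ (Finset.Icc 0 N) X) {G : ℕ → ℕ → Matrix (Fin d) (Fin d) ℝ}
    {Q : ℕ → Matrix (Fin d) (Fin d) ℝ} (hG : IsCMModel μ N c (centered μ X) G Q)
    {Γ : ℕ → Matrix (Fin d) (Fin d) ℝ} (hY : IsMarkovRep μ N c X Y Γ) :
    covMat μ (X c) (X c) = Q c ∧
      IsMarkovModel μ (timesOff N c) (centered μ Y) G Q ∧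
      (c = N → Γ 0 = G 0 N) ∧ (c = 0 → Γ 1 = (2 : ℝ) • G 1 0) ∧
      ∀ k, k ∈ timesOff N c → k + 1 ∈ timesOff N c →
        Γ (k + 1) = G (k + 1) k * Γ k + G (k + 1) c := by
  obtain ⟨e, he, hrec, hec, h0⟩ := hG
  have hcN : c ∈ Finset.Icc 0 N := by
    simp only [Finset.mem_Icc]
    omega
  have hc2 := hX.memLp hcN
  have hc2' := memLp_centered hc2
  have hcov : covMat μ (centered μ X c) (centered μ X c) = covMat μ (X c) (X c) := by
    rw [covMat_centered_left hc2, covMat_centered_right hc2]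
  have hdet : (covMat μ (centered μ X c) (centered μ X c)).det ≠ 0 := by
    rw [hcov]
    exact hX.det_covMat_ne_zero hcN
  have hunc : ∀ k ∈ timesOff N c, covMat μ (centered μ Y k) (centered μ X c) = 0 := by
    intro k hk
    rw [covMat_centered_left (hY.ng.memLp hk), covMat_centered_right hc2, hY.uncorrelated k hk]
  have heunc : ∀ k ∈ timesOff N c, covMat μ (e k) (centered μ X c) = 0 := by
    intro k hk
    rw [covMat_congr_ae (ae_eq_refl _) hec]
    exact he.white k (timesOff_subset hk) c hcN (mem_timesOff.1 hk).1
  have he2 : ∀ k ∈ timesOff N c, MemLp (e k) 2 μ := fun k hk => he.ng.memLp (timesOff_subset hk)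
  -- At the first time outside `c` the model involves only `X c` and noise. Substituting the
  -- representation leaves `M - Γ k` as coefficient of `X c`, and it must vanish.
  have hfirst : ∀ k ∈ timesOff N c, ∀ M : Matrix (Fin d) (Fin d) ℝ,
      centered μ X k =ᵐ[μ] (fun ω => M *ᵥ centered μ X c ω + e k ω) →
      Γ k = M ∧ centered μ Y k =ᵐ[μ] e k := by
    intro k hk M hM
    have heq : centered μ Y k =ᵐ[μ] fun ω => e k ω + (M - Γ k) *ᵥ centered μ X c ω := by
      filter_upwards [hM, hY.centered_ae_eq hk] with ω e1 e2
      rw [e1] at e2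
      rw [Matrix.sub_mulVec, add_sub, add_comm (e k ω), e2, add_sub_cancel_right]
    have hz := coeff_eq_zero (he2 k hk) hc2' heq (hunc k hk) (heunc k hk) hdet
    refine ⟨(sub_eq_zero.1 hz).symm, heq.trans (ae_of_all _ fun ω => ?_)⟩
    simp [hz]
  -- The same cancellation with a previous time present: the coefficient of `X c` gives the
  -- recursion for `Γ`, and what remains is the Markov recursion with the same noise.
  have hsucc : ∀ k, k ∈ timesOff N c → k + 1 ∈ timesOff N c →
      Γ (k + 1) = G (k + 1) k * Γ k + G (k + 1) c ∧
      centered μ Y (k + 1) =ᵐ[μ] fun ω => G (k + 1) k *ᵥ centered μ Y k ω + e (k + 1) ω := by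
    intro k hk hk'
    have hk1 := mem_timesOff.1 hk'
    have hYk2 := memLp_centered (hY.ng.memLp hk)
    have heq : centered μ Y (k + 1) =ᵐ[μ] fun ω =>
        (G (k + 1) k *ᵥ centered μ Y k ω + e (k + 1) ω) +
          (G (k + 1) k * Γ k + G (k + 1) c - Γ (k + 1)) *ᵥ centered μ X c ω := by
      filter_upwards [hrec (k + 1) (by simp only [Finset.mem_erase, Finset.mem_Icc]; omega),
        hY.centered_ae_eq hk, hY.centered_ae_eq hk'] with ω e1 e2 e3
      rw [Nat.add_sub_cancel, e2, e3] at e1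
      rw [eq_sub_of_add_eq e1, Matrix.mulVec_add, Matrix.sub_mulVec, Matrix.add_mulVec,
        Matrix.mulVec_mulVec]
      abel
    have hz := coeff_eq_zero ((memLp_mulVec hYk2 (G (k + 1) k)).add (he2 _ hk')) hc2' heq
      (hunc _ hk') ((covMat_add_left (memLp_mulVec hYk2 _) (he2 _ hk') hc2').trans (by
        rw [covMat_mulVec_left hYk2 hc2', hunc k hk, heunc _ hk', mul_zero, add_zero])) hdet
    refine ⟨(sub_eq_zero.1 hz).symm, heq.trans (ae_of_all _ fun ω => ?_)⟩
    simp [hz]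
  have hfirstN : c = N → Γ 0 = G 0 c ∧ centered μ Y 0 =ᵐ[μ] e 0 := fun h =>
    hfirst 0 (mem_timesOff.2 (by omega)) _ (h0 h)
  have hfirst0 : c = 0 → Γ 1 = (2 : ℝ) • G 1 0 ∧ centered μ Y 1 =ᵐ[μ] e 1 := by
    rintro rfl
    refine hfirst 1 (mem_timesOff.2 (by omega)) _ ?_
    filter_upwards [hrec 1 (by simp only [Finset.mem_erase, Finset.mem_Icc]; omega)] with ω hω
    rw [hω, two_smul, Matrix.add_mulVec]
  refine ⟨?_, ⟨e, he.subset timesOff_subset, fun k hk hk' => (hsucc k hk hk').2, ?_⟩, ?_,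
    fun h => (hfirst0 h).1, fun k hk hk' => (hsucc k hk hk').1⟩
  · rw [← hcov, covMat_congr_ae hec hec, he.cov_eq c hcN]
  · intro k hk hmin
    rcases hc with h | h
    · have h1 := hmin 1 (mem_timesOff.2 (by omega))
      obtain rfl : k = 1 := by
        have := mem_timesOff.1 hk
        omega
      exact (hfirst0 h).2
    · have h1 := hmin 0 (mem_timesOff.2 (by omega))
      obtain rfl : k = 0 := by omega
      exact (hfirstN h).2
  · intro h
    rw [(hfirstN h).1, h]

end Representation

end CMSeq

theorem mainTheorem9 {Ω : Type*} [MeasurableSpace Ω] (μ : Measure Ω) [IsProbabilityMeasure μ]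
    {d N c : ℕ} (hN : 1 ≤ N) (hc : c = 0 ∨ c = N) (X : CMSeq.RandSeq Ω d)
    (hX : CMSeq.IsNG μ (Finset.Icc 0 N) X) (hCM : CMSeq.IsCM μ N c X) :
    -- the representation exists, and it is zero-mean when `X` is
    (∃ (Y : CMSeq.RandSeq Ω d) (Γ : ℕ → Matrix (Fin d) (Fin d) ℝ),
      CMSeq.IsMarkovRep μ N c X Y Γ ∧
      (CMSeq.IsZeroMean μ (Finset.Icc 0 N) X → CMSeq.IsZeroMean μ (CMSeq.timesOff N c) Y)) ∧
    -- it is unique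
    (∀ (Y Y' : CMSeq.RandSeq Ω d) (Γ Γ' : ℕ → Matrix (Fin d) (Fin d) ℝ),
      CMSeq.IsMarkovRep μ N c X Y Γ → CMSeq.IsMarkovRep μ N c X Y' Γ' →
      ∀ k ∈ CMSeq.timesOff N c, Y k =ᵐ[μ] Y' k ∧ Γ k = Γ' k) ∧
    -- the (centered) sequence has a `CM_c` model
    (∃ (G : ℕ → ℕ → Matrix (Fin d) (Fin d) ℝ) (Q : ℕ → Matrix (Fin d) (Fin d) ℝ),
      CMSeq.IsCMModel μ N c (CMSeq.centered μ X) G Q) ∧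
    -- the parameters of the `CM_c` model determine those of the representation
    (∀ (G : ℕ → ℕ → Matrix (Fin d) (Fin d) ℝ) (Q : ℕ → Matrix (Fin d) (Fin d) ℝ),
      CMSeq.IsCMModel μ N c (CMSeq.centered μ X) G Q →
      ∀ (Y : CMSeq.RandSeq Ω d) (Γ : ℕ → Matrix (Fin d) (Fin d) ℝ),
        CMSeq.IsMarkovRep μ N c X Y Γ →
        -- the covariance of `X c`
        CMSeq.covMat μ (X c) (X c) = Q c ∧
        -- the underlying Markov model
        (∀ (U : ℕ → ℕ → Matrix (Fin d) (Fin d) ℝ) (R : ℕ → Matrix (Fin d) (Fin d) ℝ),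
          CMSeq.IsMarkovModel μ (CMSeq.timesOff N c) (CMSeq.centered μ Y) U R ↔
            (∀ k, k ∈ CMSeq.timesOff N c → k + 1 ∈ CMSeq.timesOff N c →
              U (k + 1) k = G (k + 1) k) ∧
            (∀ k ∈ CMSeq.timesOff N c, R k = Q k)) ∧
        -- the matrices `Γ k`
        (c = N → Γ 0 = G 0 N) ∧
        (c = 0 → Γ 1 = (2 : ℝ) • G 1 0) ∧
        (∀ k, k ∈ CMSeq.timesOff N c → k + 1 ∈ CMSeq.timesOff N c →
          Γ (k + 1) = G (k + 1) k * Γ k + G (k + 1) c)) := by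
  have hcN : c ∈ Finset.Icc 0 N := by
    simp only [Finset.mem_Icc]
    omega
  refine ⟨⟨_, _, CMSeq.exists_isMarkovRep hX hCM hcN, fun hzero k hk => ?_⟩,
    fun Y Y' Γ Γ' h h' k hk => h.unique h' hk, CMSeq.exists_isCMModel hN hX hCM hc,
    fun G Q hG Y Γ hY => ?_⟩
  · have hk' := CMSeq.timesOff_subset hk
    have hc1 := (hX.memLp hcN).integrable one_le_two
    rw [integral_sub ((hX.memLp hk').integrable one_le_two)
      ((CMSeq.memLp_mulVec (hX.memLp hcN) _).integrable one_le_two), CMSeq.integral_mulVec hc1,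
      hzero k hk', hzero c hcN]
    simp
  · obtain ⟨h1, h2, h3, h4, h5⟩ := hG.markovRep hN hc hX hY
    have hdet : ∀ k ∈ CMSeq.timesOff N c,
        (CMSeq.covMat μ (CMSeq.centered μ Y k) (CMSeq.centered μ Y k)).det ≠ 0 := by
      intro k hk
      rw [CMSeq.covMat_centered_left (hY.ng.memLp hk),
        CMSeq.covMat_centered_right (hY.ng.memLp hk)]
      exact hY.ng.det_covMat_ne_zero hk
    -- The model with parameters `G`, `Q` is one Markov model of `Y`; uniqueness gives one
    -- direction, and the converse holds because only the listed entries enter a Markov model.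
    exact ⟨h1, fun U R => ⟨fun hU => hU.unique (CMSeq.timesOff_interval hc)
      (fun k hk => CMSeq.memLp_centered (hY.ng.memLp hk)) hdet h2,
      fun h => h2.congr h.1 h.2⟩, h3, h4, h5⟩
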